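/- Let $(W,S)$ be a Coxeter system with $W$ finite, let $B^+$ be its Artin–Tits monoid with generating set $\mathbf S$ (in bijection with $S$), and let $\phi$ be an automorphism of $(W,S)$; we also denote by $\phi$ the induced automorphism of $B^+$, and form the semidirect product monoid $B^+\rtimes\langle\phi\rangle$. For $a,b$ in a monoid (or morphisms of a category, composed from left to right), $a\preccurlyeq b$ means that $a$ left-divides $b$, that is, $b=ac$ for some $c$. For $w\in W$ let $\mathbf w\in B^+$ be its canonical lift, that is, the product in $B^+$ of any reduced word of $w$; for $\mathbf I\subseteq\mathbf S$ let $w_I$ be the longest element of the parabolic subgroup generated by the corresponding subset $I$ of $S$, let $w_0=w_S$, and let $\mathbf w_{\mathbf I}$, $\mathbf w_0$ be the canonical lifts of $w_I$, $w_0$; the element $\mathbf w_{\mathbf I}^{-1}\mathbf w_0$ is the element $\delta\in B^+$ such that $\mathbf w_{\mathbf I}\delta=\mathbf w_0$. For $b\in B^+$ let $\alpha_{\mathbf I}(b)$ be the longest left-divisor of $b$ in the submonoid of $B^+$ generated by $\mathbf I$. For $\mathbf I,\mathbf J\subseteq\mathbf S$ and $b\in B^+$ we write $\mathbf I^b=\mathbf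 J$ if for every $s\in\mathbf I$ there is $t\in\mathbf J$ with $sb=bt$, and every $t\in\mathbf J$ arises in this way. Let $\mathcal I$ be the set of all conjugates of some subset of $\mathbf S$, and assume that it is stable by $\phi$. The ribbon category $B^+(\mathcal I)$ has set of objects $\mathcal I$; the morphisms from $\mathbf I$ to $\mathbf J$ are the $b\in B^+$ such that $\mathbf I^b=\mathbf J$ and $\alpha_{\mathbf I}(b)=1$, and the composition is the multiplication of $B^+$. The category $\mathcal D^+(\mathcal I)$ is the $\phi$-cyclic conjugacy category of $B^+(\mathcal I)$: its objects are the morphisms $\mathbf I\xrightarrow{\mathbf w}\phi(\mathbf I)$ of $B^+(\mathcal I)$ (here $\mathbf w$ is any element of $B^+$ that defines such a morphism). In the $\phi$-conjugacy category, which has the same objects, a morphism from $\mathbf I\xrightarrow{\mathbf w}\phi(\mathbf I)$ to $\mathbf J\xrightarrow{\mathbf w'}\phi(\mathbf J)$ is a morphism $\mathbf I\xrightarrow{b}\mathbf J$ of $B^+(\mathcal I)$ such that $b\mathbf w'=\mathbf w\phi(b)$; we denote it by $\operatorname{ad}b$. Then $\mathcal D^+(\mathcal I)$ is the subcategory generated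 by those $\operatorname{ad}v$ for which the morphism $\mathbf I\xrightarrow{v}\mathbf J$ left-divides the source $\mathbf I\xrightarrow{\mathbf w}\phi(\mathbf I)$ in $B^+(\mathcal I)$. **Theorem.** Let $\mathbf I\xrightarrow{\mathbf w}\phi(\mathbf I)$ be an object of $\mathcal D^+(\mathcal I)$, and assume that $\mathbf w_{\mathbf I}^{-1}\mathbf w_0\preccurlyeq(\mathbf w\phi)^n$ in $B^+\rtimes\langle\phi\rangle$ for some $n\ge 0$. Then $$B^+_{\mathbf w}=\{b\in B^+\mid b\cdot\mathbf w\phi=\mathbf w\phi\cdot b\text{ in }B^+\rtimes\langle\phi\rangle,\ \mathbf I^b=\mathbf I\text{ and }\alpha_{\mathbf I}(b)=1\}$$ is a submonoid of $B^+$, and the monoid of endomorphisms of $\mathbf I\xrightarrow{\mathbf w}\phi(\mathbf I)$ in $\mathcal D^+(\mathcal I)$ consists exactly of the morphisms $\operatorname{ad}b$ with $b\in B^+_{\mathbf w}$: the map $\operatorname{ad}b\mapsto b$ is an isomorphism from this monoid (with composition from left to right) onto $B^+_{\mathbf w}$. -/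

import Mathlib

open CategoryTheory

universe u v

namespace ParabolicBraid

section ArtinMonoid

variable {B : Type u}

/-- The braid relations `… s t s t = … t s t s` (with `m(s,t)` factors on each side), one for every
pair with `m(s,t) < ∞`; the value `M s t = 0` encodes `m(s,t) = ∞`. -/
def braidRel (M : CoxeterMatrix B) (x y : FreeMonoid B) : Prop :=
  ∃ i j : B, M i j ≠ 0 ∧
    x = FreeMonoid.ofList (CoxeterSystem.braidWord M i j) ∧
    y = FreeMonoid.ofList (CoxeterSystem.braidWord M j i)

/-- The Artin–Tits monoid `B⁺`. Divisibility `a ∣ b` in this monoid (and in any monoid below) is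
Mathlib's one, that is left-divisibility: `∃ c, b = a * c`. -/
def ArtinMonoid (M : CoxeterMatrix B) : Type u := PresentedMonoid (braidRel M)

instance (M : CoxeterMatrix B) : Monoid (ArtinMonoid M) :=
  inferInstanceAs (Monoid (PresentedMonoid (braidRel M)))

/-- The generator of `B⁺` attached to `s`. Subsets of the generating set of `B⁺` are encoded by
the corresponding subsets of the index type `B`. -/
def gen (M : CoxeterMatrix B) (s : B) : ArtinMonoid M := PresentedMonoid.of (braidRel M) s

/-- The parabolic submonoid generated by `I`. -/
def parabolic (M : CoxeterMatrix B) (I : Set B) : Submonoid (ArtinMonoid M) :=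
  Submonoid.closure (gen M '' I)

/-- `α_I(b) = a`: the element `a` is the longest left-divisor of `b` in the parabolic submonoid
generated by `I`, i.e. a left-divisor of `b` in this submonoid that is divisible by all the
others. -/
def IsAlpha (M : CoxeterMatrix B) (I : Set B) (b a : ArtinMonoid M) : Prop :=
  a ∈ parabolic M I ∧ a ∣ b ∧ ∀ x ∈ parabolic M I, x ∣ b → x ∣ a

/-- `J ^ b = K`: conjugation by `b` sends each generator in `J` to a generator (`s b = b t`), and
the set of generators obtained in this way is `K`. -/
def ConjEq (M : CoxeterMatrix B) (J : Set B) (b : ArtinMonoid M) (K : Set B) : Prop :=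
  (∀ s ∈ J, ∃ t ∈ K, gen M s * b = b * gen M t) ∧
    ∀ t ∈ K, ∃ s ∈ J, gen M s * b = b * gen M t

theorem ConjEq.one (M : CoxeterMatrix B) (J : Set B) : ConjEq M J 1 J :=
  ⟨fun s hs => ⟨s, hs, by simp⟩, fun s hs => ⟨s, hs, by simp⟩⟩

theorem ConjEq.mul {M : CoxeterMatrix B} {J K L : Set B} {b c : ArtinMonoid M}
    (hb : ConjEq M J b K) (hc : ConjEq M K c L) : ConjEq M J (b * c) L := by
  constructor
  · intro s hs
    obtain ⟨t, ht, e⟩ := hb.1 s hs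
    obtain ⟨r, hr, e'⟩ := hc.1 t ht
    exact ⟨r, hr, by rw [← mul_assoc, e, mul_assoc, e', mul_assoc]⟩
  · intro r hr
    obtain ⟨t, ht, e'⟩ := hc.2 r hr
    obtain ⟨s, hs, e⟩ := hb.2 t ht
    exact ⟨s, hs, by rw [← mul_assoc, e, mul_assoc, e', mul_assoc]⟩

/-- `𝓘` is the set of all conjugates of some set of generators, i.e. a connected component of
the relation `∃ b, J ^ b = K` between sets of generators. -/
def IsConjOrbit (M : CoxeterMatrix B) (𝓘 : Set (Set B)) : Prop :=
  ∃ J₀ : Set B, 𝓘 = {K | Relation.EqvGen (fun J K => ∃ b, ConjEq M J b K) J₀ K}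

end ArtinMonoid

section LongestElements

variable {B : Type u} {W : Type v} [Group W] {M : CoxeterMatrix B} (cs : CoxeterSystem M W)

/-- The canonical lift of `w ∈ W` to `B⁺`: the product in `B⁺` of a reduced word of `w`. -/
noncomputable def canonicalLift (w : W) : ArtinMonoid M :=
  ((cs.exists_isReduced w).choose.map (gen M)).prod

theorem exists_longest [Finite W] (I : Set B) :
    ∃ w ∈ Subgroup.closure (cs.simple '' I),
      ∀ v ∈ Subgroup.closure (cs.simple '' I), cs.length v ≤ cs.length w :=
  Set.exists_max_image (Subgroup.closure (cs.simple '' I) : Set W) cs.length (Set.toFinite _)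
    ⟨1, Subgroup.one_mem _⟩

/-- The longest element `w_I` of the parabolic subgroup `W_I`. -/
noncomputable def longestElement [Finite W] (I : Set B) : W := (exists_longest cs I).choose

end LongestElements

section DiagramAutomorphism

variable {B : Type u}

/-- An automorphism of the Coxeter diagram. Through its action on simple reflections it is the
same thing as an automorphism of the Coxeter system. -/
structure DiagramAut (M : CoxeterMatrix B) where
  toEquiv : B ≃ B
  map_eq : ∀ i j, M (toEquiv i) (toEquiv j) = M i j

def DiagramAut.symm {M : CoxeterMatrix B} (φ : DiagramAut M) : DiagramAut M where
  toEquiv := φ.toEquiv.symm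
  map_eq i j := by
    have := φ.map_eq (φ.toEquiv.symm i) (φ.toEquiv.symm j)
    simpa using this.symm

theorem map_alternatingWord (e : B → B) (i j : B) (m : ℕ) :
    (CoxeterSystem.alternatingWord i j m).map e =
      CoxeterSystem.alternatingWord (e i) (e j) m := by
  induction m generalizing i j with
  | zero => simp [CoxeterSystem.alternatingWord]
  | succ m ih => simp [CoxeterSystem.alternatingWord, ih]

/-- The endomorphism of `B⁺` induced by a diagram automorphism. -/
def DiagramAut.hom {M : CoxeterMatrix B} (φ : DiagramAut M) : ArtinMonoid M →* ArtinMonoid M :=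
  PresentedMonoid.lift (fun s => gen M (φ.toEquiv s)) (by
    have key : ∀ l : List B, FreeMonoid.lift (fun s => gen M (φ.toEquiv s)) (FreeMonoid.ofList l) =
        PresentedMonoid.mk (braidRel M) (FreeMonoid.ofList (l.map φ.toEquiv)) := by
      intro l
      induction l with
      | nil => rfl
      | cons a l ih =>
        rw [FreeMonoid.ofList_cons, map_mul, ih, List.map_cons, FreeMonoid.ofList_cons, map_mul]
        rfl
    rintro _ _ ⟨i, j, h, rfl, rfl⟩
    rw [key, key]
    apply PresentedMonoid.mk_eq_mk_of_rel
    refine ⟨φ.toEquiv i, φ.toEquiv j, by rwa [φ.map_eq], ?_, ?_⟩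
    · rw [CoxeterSystem.braidWord, map_alternatingWord, CoxeterSystem.braidWord, φ.map_eq]
    · rw [CoxeterSystem.braidWord, map_alternatingWord, CoxeterSystem.braidWord, φ.map_eq])

@[simp]
theorem DiagramAut.hom_gen {M : CoxeterMatrix B} (φ : DiagramAut M) (s : B) :
    φ.hom (gen M s) = gen M (φ.toEquiv s) := rfl

theorem artin_hom_ext {M : CoxeterMatrix B} {f g : ArtinMonoid M →* ArtinMonoid M}
    (h : ∀ s, f (gen M s) = g (gen M s)) : f = g :=
  PresentedMonoid.ext (rels := braidRel M) h

/-- The automorphism of `B⁺` induced by a diagram automorphism. -/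
def DiagramAut.aut {M : CoxeterMatrix B} (φ : DiagramAut M) : MulAut (ArtinMonoid M) :=
  MonoidHom.toMulEquiv φ.hom φ.symm.hom
    (artin_hom_ext (fun s => by simp [DiagramAut.symm]))
    (artin_hom_ext (fun s => by simp [DiagramAut.symm]))

@[simp]
theorem DiagramAut.aut_gen {M : CoxeterMatrix B} (φ : DiagramAut M) (s : B) :
    φ.aut (gen M s) = gen M (φ.toEquiv s) := rfl

theorem DiagramAut.aut_symm_gen {M : CoxeterMatrix B} (φ : DiagramAut M) (s : B) :
    φ.aut.symm (gen M s) = gen M (φ.toEquiv.symm s) := rfl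

end DiagramAutomorphism

section Semidirect

/-- The semidirect product monoid `A ⋊ ⟨φ⟩`, whose elements are written `a φⁱ`. -/
@[ext]
structure Semidirect (A : Type u) [Monoid A] (φ : MulAut A) where
  left : A
  right : Subgroup.zpowers φ

variable {A : Type u} [Monoid A] {φ : MulAut A}

/-- `(a ψ)(b χ) = a ψ(b) ψχ`. -/
instance : Monoid (Semidirect A φ) where
  mul x y := ⟨x.left * (x.right : MulAut A) y.left, x.right * y.right⟩
  one := ⟨1, 1⟩
  mul_assoc x y z := by
    apply Semidirect.ext
    · change x.left * (x.right : MulAut A) y.left *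
          ((x.right * y.right : Subgroup.zpowers φ) : MulAut A) z.left =
        x.left * (x.right : MulAut A) (y.left * (y.right : MulAut A) z.left)
      simp [mul_assoc]
    · exact mul_assoc x.right y.right z.right
  one_mul x := by
    apply Semidirect.ext
    · change 1 * ((1 : Subgroup.zpowers φ) : MulAut A) x.left = x.left
      simp
    · exact one_mul x.right
  mul_one x := by
    apply Semidirect.ext
    · change x.left * (x.right : MulAut A) 1 = x.left
      simp
    · exact mul_one x.right

/-- The element `a` of `A`, viewed in `A ⋊ ⟨φ⟩`. -/
def Semidirect.inl (φ : MulAut A) (a : A) : Semidirect A φ := ⟨a, 1⟩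

/-- The element `a φ` of `A ⋊ ⟨φ⟩`. -/
def Semidirect.coset (φ : MulAut A) (a : A) : Semidirect A φ :=
  ⟨a, ⟨φ, Subgroup.mem_zpowers φ⟩⟩

end Semidirect

section CyclicConjugacy

variable {C : Type u} [Category.{v} C]

/-- An object of the `F`-conjugacy category of `C`: a morphism `w : A ⟶ F A`. -/
structure FAd (F : C ⥤ C) where
  base : C
  mor : base ⟶ F.obj base

/-- The `F`-conjugacy category: a morphism from `w` to `w'` is a morphism `x` of `C` such that
`x w' = w F(x)`. -/
instance (F : C ⥤ C) : Category (FAd F) where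
  Hom w w' := {x : w.base ⟶ w'.base // x ≫ w'.mor = w.mor ≫ F.map x}
  id w := ⟨𝟙 _, by simp⟩
  comp {_ _ _} x y := ⟨x.1 ≫ y.1, by
    rw [Category.assoc, y.2, ← Category.assoc, x.2, Category.assoc, F.map_comp]⟩
  id_comp _ := Subtype.ext (Category.id_comp _)
  comp_id _ := Subtype.ext (Category.comp_id _)
  assoc _ _ _ := Subtype.ext (Category.assoc _ _ _)

/-- The simple morphisms of the `F`-conjugacy category: those morphisms `x` with source `w`
such that `x` left-divides `w` in `C`. -/
def simpleFAd (F : C ⥤ C) : MorphismProperty (FAd F) :=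
  fun w _ x => ∃ y, w.mor = x.1 ≫ y

/-- The `F`-cyclic conjugacy category: the subcategory of the `F`-conjugacy category, with the
same objects, generated by the simple morphisms. -/
abbrev FCyc (F : C ⥤ C) := WideSubcategory (simpleFAd F).multiplicativeClosure

end CyclicConjugacy

section Ribbon

variable {B : Type u}

/-- An object of `Ad(B⁺, 𝓘)`: an element of `𝓘`. -/
structure AdObj (M : CoxeterMatrix B) (𝓘 : Set (Set B)) where
  carrier : Set B
  mem : carrier ∈ 𝓘

/-- The simultaneous conjugacy category `Ad(B⁺, 𝓘)`: a morphism from `J` to `K` is an element `b`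
of `B⁺` such that `J ^ b = K`; composition is multiplication in `B⁺`. -/
instance (M : CoxeterMatrix B) (𝓘 : Set (Set B)) : Category (AdObj M 𝓘) where
  Hom J K := {b : ArtinMonoid M // ConjEq M J.carrier b K.carrier}
  id J := ⟨1, ConjEq.one M J.carrier⟩
  comp {_ _ _} f g := ⟨f.1 * g.1, f.2.mul g.2⟩
  id_comp _ := Subtype.ext (one_mul _)
  comp_id _ := Subtype.ext (mul_one _)
  assoc _ _ _ := Subtype.ext (mul_assoc _ _ _)

/-- The morphisms `b` of `Ad(B⁺, 𝓘)` with source `J` such that `α_J(b) = 1`. -/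
def reduced (M : CoxeterMatrix B) (𝓘 : Set (Set B)) : MorphismProperty (AdObj M 𝓘) :=
  fun J _ b => IsAlpha M J.carrier b.1 1

/-- The ribbon category `B⁺(𝓘)`: the subcategory of `Ad(B⁺, 𝓘)`, with the same objects, given by
the morphisms `b` with source `J` such that `α_J(b) = 1`. It is written here as the subcategory
generated by these morphisms; as is well known, they are stable by composition, so that there are
no other morphisms in it. -/
abbrev RibbonCat (M : CoxeterMatrix B) (𝓘 : Set (Set B)) :=
  WideSubcategory (reduced M 𝓘).multiplicativeClosure

variable {M : CoxeterMatrix B} {𝓘 : Set (Set B)}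

theorem ConjEq.map (φ : DiagramAut M) {J K : Set B} {b : ArtinMonoid M} (h : ConjEq M J b K) :
    ConjEq M (φ.toEquiv '' J) (φ.aut b) (φ.toEquiv '' K) := by
  constructor
  · rintro _ ⟨s, hs, rfl⟩
    obtain ⟨t, ht, e⟩ := h.1 s hs
    exact ⟨_, ⟨t, ht, rfl⟩, by rw [← φ.aut_gen, ← φ.aut_gen, ← map_mul, e, map_mul]⟩
  · rintro _ ⟨t, ht, rfl⟩
    obtain ⟨s, hs, e⟩ := h.2 t ht
    exact ⟨_, ⟨s, hs, rfl⟩, by rw [← φ.aut_gen, ← φ.aut_gen, ← map_mul, e, map_mul]⟩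

theorem parabolic_map (φ : DiagramAut M) (J : Set B) :
    (parabolic M J).map (φ.aut : ArtinMonoid M →* ArtinMonoid M) =
      parabolic M (φ.toEquiv '' J) := by
  rw [parabolic, MonoidHom.map_mclosure, parabolic, Set.image_image, Set.image_image]
  rfl

theorem IsAlpha.map (φ : DiagramAut M) {J : Set B} {b a : ArtinMonoid M} (h : IsAlpha M J b a) :
    IsAlpha M (φ.toEquiv '' J) (φ.aut b) (φ.aut a) := by
  refine ⟨?_, map_dvd φ.aut h.2.1, ?_⟩
  · rw [← parabolic_map]
    exact ⟨a, h.1, rfl⟩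
  · intro x hx hxb
    rw [← parabolic_map] at hx
    obtain ⟨y, hy, rfl⟩ := hx
    refine map_dvd φ.aut (h.2.2 y hy ?_)
    have := map_dvd φ.aut.symm hxb
    simpa using this

/-- The functor induced by `φ` on `Ad(B⁺, 𝓘)` when `φ` stabilizes `𝓘`. -/
def adFunctor (φ : DiagramAut M) (hφ : ∀ J ∈ 𝓘, φ.toEquiv '' J ∈ 𝓘) :
    AdObj M 𝓘 ⥤ AdObj M 𝓘 where
  obj J := ⟨φ.toEquiv '' J.carrier, hφ _ J.mem⟩
  map {_ _} b := ⟨φ.aut b.1, b.2.map φ⟩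
  map_id _ := Subtype.ext (map_one φ.aut)
  map_comp _ _ := Subtype.ext (map_mul φ.aut _ _)

theorem ribbon_map (φ : DiagramAut M) (hφ : ∀ J ∈ 𝓘, φ.toEquiv '' J ∈ 𝓘) {J K : AdObj M 𝓘}
    {f : J ⟶ K} (hf : (reduced M 𝓘).multiplicativeClosure f) :
    (reduced M 𝓘).multiplicativeClosure ((adFunctor φ hφ).map f) := by
  have key : ∀ {J K : AdObj M 𝓘} (f : J ⟶ K), reduced M 𝓘 f →
      reduced M 𝓘 ((adFunctor φ hφ).map f) := by
    intro J K f hf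
    have := IsAlpha.map φ hf
    rwa [map_one] at this
  induction hf with
  | of f hf => exact .of _ (key _ hf)
  | id x => rw [(adFunctor φ hφ).map_id]; exact .id _
  | comp_of f g _ hg ih =>
    rw [(adFunctor φ hφ).map_comp]
    exact .comp_of _ _ ih (key _ hg)

/-- The functor induced by `φ` on the ribbon category `B⁺(𝓘)` when `φ` stabilizes `𝓘`. -/
def ribbonFunctor (φ : DiagramAut M) (hφ : ∀ J ∈ 𝓘, φ.toEquiv '' J ∈ 𝓘) :
    RibbonCat M 𝓘 ⥤ RibbonCat M 𝓘 where
  obj J := ⟨(adFunctor φ hφ).obj J.obj⟩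
  map {_ _} b := ⟨(adFunctor φ hφ).map b.hom, ribbon_map φ hφ b.property⟩
  map_id _ := WideSubcategory.hom_ext _ ((adFunctor φ hφ).map_id _)
  map_comp _ _ := WideSubcategory.hom_ext _ ((adFunctor φ hφ).map_comp _ _)

/-- The category `𝒟⁺(𝓘)`: the `φ`-cyclic conjugacy category of the ribbon category `B⁺(𝓘)`. Its
objects are the morphisms `I ⟶ φ(I)` of `B⁺(𝓘)`. -/
abbrev DPlus (φ : DiagramAut M) (hφ : ∀ J ∈ 𝓘, φ.toEquiv '' J ∈ 𝓘) :=
  FCyc (ribbonFunctor φ hφ)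

variable {φ : DiagramAut M} {hφ : ∀ J ∈ 𝓘, φ.toEquiv '' J ∈ 𝓘}

/-- The set of generators `I` underlying an object `w : I ⟶ φ(I)` of `𝒟⁺(𝓘)`. -/
def DPlus.source (X : DPlus φ hφ) : Set B := X.obj.base.obj.carrier

/-- The element `w` of `B⁺` underlying an object `w : I ⟶ φ(I)` of `𝒟⁺(𝓘)`. -/
def DPlus.elt (X : DPlus φ hφ) : ArtinMonoid M := X.obj.mor.hom.1

/-- The element `b` of `B⁺` underlying a morphism `ad b` of `𝒟⁺(𝓘)`: the composite of the simple
morphisms `ad v₁, …, ad vₖ` is `ad b` with `b = v₁ ⋯ vₖ`. -/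
def DPlus.adElt {X Y : DPlus φ hφ} (f : X ⟶ Y) : ArtinMonoid M := f.hom.1.hom.1

end Ribbon

end ParabolicBraid

/-! The inclusion to prove is that `ad b` is a product of simple morphisms for every `b` in `B⁺_w`;
the rest is formal once ribbons are known to be stable by product.

Write `w⁽ᴺ⁾ = w φ(w) ⋯ φᴺ⁻¹(w)`, the `B⁺`-part of `(wφ)ᴺ`. The hypothesis makes `w_I w⁽ⁿ⁾` a
multiple of `w₀`. Since the lift of `w₀` is quasi-central and every generator divides it, each
element of `B⁺` divides some `a w⁽ᴺ⁾` with `a` in `B_I⁺` (`exists_dvd_parabolic_mul_twistedPow`). If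
`b` is a ribbon from `I`, then `a` and `b` have `ab` as least common multiple, so `ab` divides `a
w⁽ᴺ⁾` and, by cancellation, `b` divides `w⁽ᴺ⁾` (`IsRibbon.mul_dvd_of_dvd`,
`IsRibbon.exists_dvd_twistedPow`).

It remains to factor a `b` with `b w' = w φ(b)` and `b ∣ w⁽ᴺ⁾`. Let `g` be the left gcd of `b` and
`w`; it is again a ribbon (`IsRibbon.gcd`). If `g = 1`, then `b` is prime to every `w⁽ᴺ⁾`, so `b =
1` (`eq_one_of_dvd_twistedPow`). Otherwise write `b = g b₁`, `w = g w₁`: `ad g` is simple from `w`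
to `w₁ φ(g)`, and the shorter `b₁` satisfies the same hypotheses at this new source
(`multiplicativeClosure_simpleFAd_of_dvd`).

All this rests on left cancellation and left gcds in `B⁺`. They follow from one fact: `s x = t y`
forces both sides to be multiples of the lcm of `s` and `t` (`isLcmMultiple_of_mul_eq`). Its core,
the cube condition (`cube`), is transported to the finite group `W` by canonical lifts, whence the
Coxeter theory developed first. -/

namespace ParabolicBraid

/-! ### The exchange condition, from counting inversions modulo 2. -/

section Exchange

variable {B : Type u} {W : Type v} [Group W] {M : CoxeterMatrix B} (cs : CoxeterSystem M W)

open Classical in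
theorem involutive_conj_add_indicator {a : W} (ha : a * a = 1) :
    Function.Involutive fun p : W × ZMod 2 =>
      (a * p.1 * a, p.2 + if p.1 = a then (1 : ZMod 2) else 0) := by
  intro p
  have h1 : a * (a * p.1 * a) * a = p.1 := by
    rw [show a * (a * p.1 * a) * a = (a * a) * p.1 * (a * a) by simp only [mul_assoc], ha]; simp
  have h2 : a * p.1 * a = a ↔ p.1 = a := by
    constructor
    · intro h
      have := congrArg (fun x => a * x * a) h
      simp only [h1] at this
      rw [this, ha, one_mul]
    · intro h; rw [h, ha, one_mul]
  refine Prod.ext h1 ?_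
  simp only [h2]
  rw [add_assoc, CharTwo.add_self_eq_zero, add_zero]

/-- The permutation of `W × ℤ/2` attached to an involution `a`. -/
noncomputable def reflPerm (a : W) (ha : a * a = 1) : Equiv.Perm (W × ZMod 2) :=
  (involutive_conj_add_indicator ha).toPerm

open Classical in
theorem reflPerm_apply (a : W) (ha : a * a = 1) (p : W × ZMod 2) :
    reflPerm a ha p = (a * p.1 * a, p.2 + if p.1 = a then 1 else 0) := rfl

open Classical in
-- Each factor tests one more reflection of the dihedral group generated by `a` and `b`; the
-- identity `b (ab)ⁿ = (ab)⁻ⁿ b` puts all of them in the uniform form `(ab)⁻ⁿ b`.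
theorem reflPerm_mul_pow_apply (a b : W) (ha : a * a = 1) (hb : b * b = 1) (k : ℕ)
    (p : W × ZMod 2) :
    ((reflPerm a ha * reflPerm b hb) ^ k) p =
      ((a * b) ^ k * p.1 * ((a * b) ^ k)⁻¹,
        p.2 + ∑ n ∈ Finset.range (2 * k), if p.1 = ((a * b) ^ n)⁻¹ * b then 1 else 0) := by
  have ha' : a⁻¹ = a := inv_eq_of_mul_eq_one_left ha
  have hb' : b⁻¹ = b := inv_eq_of_mul_eq_one_left hb
  have hconj : ∀ n : ℕ, b * (a * b) ^ n = ((a * b) ^ n)⁻¹ * b := by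
    intro n
    have : b * (a * b) * b⁻¹ = (a * b)⁻¹ := by
      rw [mul_inv_rev, ha', hb']; simp only [mul_assoc]; rw [hb, mul_one]
    have h2 := conj_pow (a := b) (b := a * b) (i := n)
    rw [this] at h2
    rw [← inv_pow, h2, inv_mul_cancel_right]
  induction k with
  | zero => simp
  | succ k ih =>
    rw [pow_succ', Equiv.Perm.mul_apply, ih, Equiv.Perm.mul_apply, reflPerm_apply, reflPerm_apply]
    refine Prod.ext ?_ ?_
    · simp only [pow_succ' (a * b) k, mul_inv_rev, ha', hb', mul_assoc]
    · simp only [show 2 * (k + 1) = 2 * k + 1 + 1 by ring, Finset.sum_range_succ]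
      have e1 : ((a * b) ^ k * p.1 * ((a * b) ^ k)⁻¹ = b) ↔
          p.1 = ((a * b) ^ (2 * k))⁻¹ * b := by
        rw [mul_inv_eq_iff_eq_mul, hconj, ← eq_inv_mul_iff_mul_eq, ← mul_assoc, two_mul, pow_add,
          mul_inv_rev]
      have e2 : (b * ((a * b) ^ k * p.1 * ((a * b) ^ k)⁻¹) * b = a) ↔
          p.1 = ((a * b) ^ (2 * k + 1))⁻¹ * b := by
        have : (b * ((a * b) ^ k * p.1 * ((a * b) ^ k)⁻¹) * b = a) ↔
            (a * b) ^ k * p.1 * ((a * b) ^ k)⁻¹ = b * a * b := by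
          constructor
          · intro h
            have := congrArg (fun x => b * x * b) h
            simp only [mul_assoc, hb, mul_one] at this
            rw [← mul_assoc b b, hb, one_mul] at this
            simpa only [mul_assoc] using this
          · intro h
            rw [h]
            simp only [mul_assoc, hb, mul_one]
            rw [← mul_assoc b b, hb, one_mul]
        rw [this, mul_inv_eq_iff_eq_mul, mul_assoc, hconj, ← eq_inv_mul_iff_mul_eq,
          show 2 * k + 1 = k + 1 + k by ring, pow_add, pow_add, pow_one, mul_inv_rev, mul_inv_rev,
          mul_inv_rev a b, ha', hb']
        simp only [mul_assoc]
      simp only [e1, e2, add_assoc]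

/-- At `k = M i j` the summand is periodic of period `M i j` over a range of length `2 M i j`, so
every term occurs twice and the sum vanishes modulo 2. -/
theorem reflPerm_isLiftable :
    M.IsLiftable (fun i => reflPerm (cs.simple i) (cs.simple_mul_simple_self i)) := by
  classical
  intro i j
  ext1 p
  rw [reflPerm_mul_pow_apply, cs.simple_mul_simple_pow, two_mul, Finset.sum_range_add]
  simp only [pow_add, cs.simple_mul_simple_pow, one_mul, CharTwo.add_self_eq_zero, add_zero]
  simp

/-- The action of `W` on `W × ℤ/2` which counts inversions modulo 2. -/
noncomputable def inversionHom : W →* Equiv.Perm (W × ZMod 2) :=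
  cs.lift ⟨_, reflPerm_isLiftable cs⟩

open Classical in
-- As the left side depends only on the element, so does the parity of the multiplicity of a
-- reflection in the inversion sequence of a word.
theorem inversionHom_wordProd (ω : List B) (p : W × ZMod 2) :
    inversionHom cs (cs.wordProd ω) p =
      (cs.wordProd ω * p.1 * (cs.wordProd ω)⁻¹, p.2 + ((cs.rightInvSeq ω).count p.1 : ℕ)) := by
  induction ω with
  | nil => simp
  | cons i ω ih =>
    rw [cs.wordProd_cons, map_mul, Equiv.Perm.mul_apply, ih, inversionHom, cs.lift_apply_simple,
      reflPerm_apply]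
    refine Prod.ext ?_ ?_
    · simp [mul_assoc]
    · simp only [CoxeterSystem.rightInvSeq, List.count_cons, Nat.cast_add, add_assoc]
      congr 2
      have : (cs.wordProd ω * p.1 * (cs.wordProd ω)⁻¹ = cs.simple i) ↔
          (cs.wordProd ω)⁻¹ * cs.simple i * cs.wordProd ω = p.1 := by
        rw [mul_inv_eq_iff_eq_mul, mul_assoc, inv_mul_eq_iff_eq_mul, eq_comm]
      simp [this]

/-- A left descent `i` gives a reduced word starting with `i`, in whose inversion sequence `s_i`
occurs exactly once. By invariance of parity it occurs an odd number of times in that of `ω`. -/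
theorem simple_mem_leftInvSeq {ω : List B} {i : B} (h : cs.IsLeftDescent (cs.wordProd ω) i) :
    cs.simple i ∈ cs.leftInvSeq ω := by
  classical
  obtain ⟨ω', hω', e⟩ := cs.exists_isReduced (cs.simple i * cs.wordProd ω)
  have e1 : cs.wordProd (i :: ω') = cs.wordProd ω := by
    rw [cs.wordProd_cons, ← e, cs.simple_mul_simple_cancel_left]
  have hred : cs.IsReduced (i :: ω') := by
    have := cs.isLeftDescent_iff.1 h
    rw [e, hω'.eq] at this
    rw [CoxeterSystem.IsReduced, e1, ← this, List.length_cons]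
  have hc : (cs.leftInvSeq (i :: ω')).count (cs.simple i) = 1 :=
    List.count_eq_one_of_mem hred.nodup_leftInvSeq (by simp [CoxeterSystem.leftInvSeq])
  have key : ∀ ω₁ : List B, (inversionHom cs (cs.wordProd ω₁)⁻¹ (cs.simple i, 0)).2 =
      ((cs.leftInvSeq ω₁).count (cs.simple i) : ℕ) := by
    intro ω₁
    rw [← cs.wordProd_reverse, inversionHom_wordProd, cs.rightInvSeq_reverse, List.count_reverse]
    simp
  have h1 := key ω
  rw [← e1, key, hc] at h1
  by_contra hn
  rw [List.count_eq_zero_of_not_mem hn] at h1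
  simp at h1

/-- The exchange condition. -/
theorem exchange {ω : List B} {i : B} (h : cs.IsLeftDescent (cs.wordProd ω) i) :
    ∃ k < ω.length, cs.simple i * cs.wordProd ω = cs.wordProd (ω.eraseIdx k) := by
  obtain ⟨k, hk, hk'⟩ := List.getElem_of_mem (simple_mem_leftInvSeq cs h)
  rw [cs.length_leftInvSeq] at hk
  refine ⟨k, hk, ?_⟩
  rw [← cs.getD_leftInvSeq_mul_wordProd, List.getD_eq_getElem _ _ (by simpa using hk), hk']

end Exchange

/-! ### The geometric representation and the exact order of `s_i s_j`. -/

section GeometricRepresentation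

open Module Polynomial.Chebyshev Real

variable {B : Type u} (M : CoxeterMatrix B)

/-- The linear form `2 B(α_i, ·)` of the geometric representation. -/
noncomputable def rootForm (i : B) : Dual ℝ (B →₀ ℝ) :=
  -- The encoding `M i j = 0` of infinity yields `π / 0 = 0`, hence the customary value `-2`; the
  -- diagonal entry `1` yields `2`.
  Finsupp.linearCombination ℝ fun j => -2 * cos (π / M i j)

theorem rootForm_single (i j : B) :
    rootForm M i (Finsupp.single j 1) = -2 * cos (π / M i j) := by
  simp [rootForm]

theorem rootForm_self (i : B) : rootForm M i (Finsupp.single i 1) = 2 := by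
  simp [rootForm_single]

/-- The reflection of the geometric representation attached to `i`. -/
noncomputable def rootReflection (i : B) : (B →₀ ℝ) ≃ₗ[ℝ] (B →₀ ℝ) :=
  reflection (rootForm_self M i)

theorem rootParam_eq (i j : B) :
    (2 * cos (2 * (π / M i j)) : ℝ) =
      rootForm M i (Finsupp.single j 1) * rootForm M j (Finsupp.single i 1) - 2 := by
  rw [rootForm_single, rootForm_single, M.symmetric j i, cos_two_mul]
  ring

theorem sin_two_mul_pi_div_pos {m : ℕ} (hm : 3 ≤ m) : 0 < sin (2 * (π / m)) := by
  have hm' : (3 : ℝ) ≤ m := by exact_mod_cast hm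
  have hpi := pi_pos
  apply sin_pos_of_pos_of_lt_pi
  · positivity
  · rw [← mul_div_assoc, div_lt_iff₀ (by linarith)]
    nlinarith

theorem chebyshevS_eval_eq {θ : ℝ} (h : sin θ ≠ 0) (n : ℤ) :
    (S ℝ n).eval (2 * cos θ) = sin ((n + 1) * θ) / sin θ := by
  rw [eq_div_iff h, S_two_mul_real_cos]

/-- For `m = M i j ≥ 3` and `θ = 2π/m`, powers of the product of two reflections have Chebyshev
coefficients `sin((n+1)θ)/sin θ`. At the `m`-th power these vanish for `m = 2p` because `pθ = π`,
and cancel in pairs for `m = 2p + 1` because `(p+1)θ = π + θ/2` and `pθ = π - θ/2`. The case `m = 2`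
is separate since then `sin θ = 0`. -/
theorem rootReflection_isLiftable : M.IsLiftable (rootReflection M) := by
  intro i j
  rcases eq_or_ne i j with rfl | hij
  · rw [M.diagonal, pow_one]
    exact LinearEquiv.ext fun z => involutive_reflection (rootForm_self M i) z
  have h1 := M.off_diagonal i j hij
  obtain h0 | h2 | h3 : M i j = 0 ∨ M i j = 2 ∨ 3 ≤ M i j := by lia
  · rw [h0, pow_zero]
  · have e1 : rootForm M i (Finsupp.single j 1) = 0 := by rw [rootForm_single, h2]; simp
    have e2 : rootForm M j (Finsupp.single i 1) = 0 := by
      rw [rootForm_single, M.symmetric j i, h2]; simp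
    rw [h2, pow_two]
    apply LinearEquiv.ext
    intro z
    simp only [rootReflection, LinearEquiv.mul_apply, reflection_apply, map_sub, map_smul,
      e1, e2, rootForm_self, LinearEquiv.coe_one, id]
    module
  · apply LinearEquiv.ext
    intro z
    have hs := (sin_two_mul_pi_div_pos h3).ne'
    have hm : (M i j : ℝ) ≠ 0 := by positivity
    rw [rootReflection, rootReflection, reflection_mul_reflection_pow_apply _ _ _ _ _
      (rootParam_eq M i j)]
    simp only [chebyshevS_eval_eq hs]
    obtain ⟨p, hp | hp⟩ := Nat.even_or_odd' (M i j)
    · have a1 : ((M i j : ℤ) - 2) / 2 = p - 1 := by lia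
      have a2 : ((M i j : ℤ) - 1) / 2 = p - 1 := by lia
      have a3 : ((M i j : ℤ)) / 2 = p := by lia
      have key : sin (((p - 1 : ℤ) + 1 : ℝ) * (2 * (π / M i j))) = 0 := by
        rw [show (((p - 1 : ℤ) + 1 : ℝ) * (2 * (π / M i j))) = π by
          rw [hp] at hm ⊢; push_cast at hm ⊢
          have : (p : ℝ) ≠ 0 := by simpa using hm
          field_simp; ring, sin_pi]
      rw [a1, a2, key]
      simp
    · have a1 : ((M i j : ℤ) - 2) / 2 = p - 1 := by lia
      have a2 : ((M i j : ℤ) - 1) / 2 = p := by lia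
      have a3 : ((M i j : ℤ)) / 2 = p := by lia
      have a4 : ((M i j : ℤ) - 3) / 2 = p - 1 := by lia
      have key : sin (((p : ℤ) + 1 : ℝ) * (2 * (π / M i j))) / sin (2 * (π / M i j)) +
          sin (((p - 1 : ℤ) + 1 : ℝ) * (2 * (π / M i j))) / sin (2 * (π / M i j)) = 0 := by
        rw [show (((p : ℤ) + 1 : ℝ) * (2 * (π / M i j))) = π / M i j + π by
            rw [hp] at hm ⊢; push_cast at hm ⊢; field_simp; ring,
          show (((p - 1 : ℤ) + 1 : ℝ) * (2 * (π / M i j))) = π - π / M i j by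
            rw [hp] at hm ⊢; push_cast at hm ⊢; field_simp; ring,
          sin_add_pi, sin_pi_sub]
        ring
      rw [a1, a2, a3, a4, key]
      simp

variable {M}
variable {W : Type v} [Group W] (cs : CoxeterSystem M W)

/-- The relations of the presentation do not collapse: the image of `(s_i s_j)^l` in the geometric
representation is applied to the root `α_i` and its two coordinates are compared with those of
`α_i`. -/
theorem coxeterMatrix_le_of_pow_eq_one {i j : B} {l : ℕ} (hl : 0 < l)
    (h : (cs.simple i * cs.simple j) ^ l = 1) : M i j ≠ 0 ∧ M i j ≤ l := by
  rcases eq_or_ne i j with rfl | hij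
  · simpa using Nat.succ_le_of_lt hl
  have h1 := M.off_diagonal i j hij
  have h2 := congrArg (cs.lift ⟨_, rootReflection_isLiftable M⟩) h
  rw [map_pow, map_mul, cs.lift_apply_simple, cs.lift_apply_simple, map_one] at h2
  have h3 := congrArg (fun f => f (Finsupp.single i 1)) h2
  simp only [rootReflection, LinearEquiv.coe_one, id] at h3
  rw [reflection_mul_reflection_pow_apply_self _ _ _ _ (rootParam_eq M i j)] at h3
  have hi := congrArg (fun f => f i) h3
  have hj := congrArg (fun f => f j) h3
  simp only [Finsupp.add_apply, Finsupp.smul_apply, Finsupp.single_eq_same, smul_eq_mul,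
    Finsupp.single_eq_of_ne hij, Finsupp.single_eq_of_ne hij.symm, mul_zero, mul_one, add_zero,
    zero_add, rootForm_single, M.symmetric j i] at hi hj
  by_contra hcon
  obtain h0 | h2 | ⟨h3, hlt⟩ : M i j = 0 ∨ (M i j = 2 ∧ l = 1) ∨ (3 ≤ M i j ∧ l < M i j) := by
    lia
  · rw [h0] at hj
    simp [S_eval_two] at hj
    lia
  · rw [h2.1, h2.2] at hi
    norm_num at hi
    simp [mul_div_cancel₀] at hi
  · have hs := (sin_two_mul_pi_div_pos h3)
    have hpi := pi_pos
    have hm : (3 : ℝ) ≤ M i j := by exact_mod_cast h3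
    have hl' : (0 : ℝ) < l := by exact_mod_cast hl
    have hlt' : (l : ℝ) < M i j := by exact_mod_cast hlt
    have hc : cos (π / M i j) ≠ 0 := by
      apply ne_of_gt
      apply cos_pos_of_mem_Ioo
      constructor
      · have : 0 < π / M i j := by positivity
        linarith
      · rw [div_lt_div_iff₀ (by linarith) (by norm_num)]
        nlinarith
    rw [chebyshevS_eval_eq hs.ne'] at hi hj
    rw [chebyshevS_eval_eq hs.ne'] at hi
    have hj' : sin (l * (2 * (π / M i j))) = 0 := by
      have : sin (2 * (π / M i j)) ≠ 0 := hs.ne'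
      simpa [hc, this] using hj
    rw [sin_eq_zero_iff] at hj'
    obtain ⟨n, hn⟩ := hj'
    have hn' : (n : ℝ) * M i j = 2 * l := by
      field_simp at hn
      linarith
    -- The coordinate on `α_j` gives `2l = n M i j`, and `0 < l < M i j` leaves only `n = 1`. Then
    -- `lθ = π`, and the coordinate on `α_i` is `-1` instead of `1`.
    have hn1 : n = 1 := by
      have a : 0 < n := by
        by_contra hneg
        have : (n : ℝ) ≤ 0 := by exact_mod_cast not_lt.1 hneg
        nlinarith
      have b : n < 2 := by
        by_contra hneg
        have : (2 : ℝ) ≤ n := by exact_mod_cast not_lt.1 hneg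
        nlinarith
      lia
    rw [hn1] at hn
    have e1 : (((l : ℤ) : ℝ) + 1) * (2 * (π / M i j)) = 2 * (π / M i j) + π := by
      push_cast at hn ⊢; linarith
    have e2 : (((l - 1 : ℤ) : ℝ) + 1) * (2 * (π / M i j)) = π := by
      push_cast at hn ⊢; linarith
    rw [e1, e2, sin_add_pi, sin_pi, neg_div, div_self hs.ne'] at hi
    norm_num at hi

theorem coxeterMatrix_ne_zero (cs : CoxeterSystem M W) [Finite W] (i j : B) : M i j ≠ 0 :=
  (coxeterMatrix_le_of_pow_eq_one cs (isOfFinOrder_of_finite _).orderOf_pos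
    (pow_orderOf_eq_one (cs.simple i * cs.simple j))).1

end GeometricRepresentation

/-! ### Alternating words, descents and the weak order of a finite Coxeter group. -/

section WeakOrder

variable {B : Type u} {W : Type v} [Group W] {M : CoxeterMatrix B} (cs : CoxeterSystem M W)

/-- The word of length `k` that alternates between `i` and `j`, starting with `i`. -/
def altWord : B → B → ℕ → List B
  | _, _, 0 => []
  | i, j, k + 1 => i :: altWord j i k

theorem altWord_succ (i j : B) (k : ℕ) : altWord i j (k + 1) = i :: altWord j i k := rfl

@[simp]
theorem length_altWord (i j : B) (k : ℕ) : (altWord i j k).length = k := by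
  induction k generalizing i j with
  | zero => rfl
  | succ k ih => simp [altWord_succ, ih]

theorem alternatingWord_eq (i j : B) (k : ℕ) :
    CoxeterSystem.alternatingWord i j k = if Even k then altWord i j k else altWord j i k := by
  induction k generalizing i j with
  | zero => rfl
  | succ k ih =>
    rw [CoxeterSystem.alternatingWord_succ', ih]
    by_cases h : Even k <;> simp [h, altWord_succ, Nat.even_add_one, -Nat.not_even_iff_odd]

theorem altWord_eq_take {i j : B} {k p : ℕ} (h : k < 2 * p) :
    altWord i j k = (CoxeterSystem.alternatingWord i j (2 * p)).take k := by
  rw [CoxeterSystem.listTake_alternatingWord i j p k h, alternatingWord_eq, alternatingWord_eq]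
  split_ifs <;> rfl

theorem braidWord_eq_altWord (i j : B) :
    (CoxeterSystem.braidWord M i j = altWord i j (M i j) ∧
      CoxeterSystem.braidWord M j i = altWord j i (M i j)) ∨
    (CoxeterSystem.braidWord M i j = altWord j i (M i j) ∧
      CoxeterSystem.braidWord M j i = altWord i j (M i j)) := by
  rw [CoxeterSystem.braidWord, CoxeterSystem.braidWord, M.symmetric j i, alternatingWord_eq,
    alternatingWord_eq]
  split_ifs <;> simp

theorem wordProd_altWord_comm (i j : B) :
    cs.wordProd (altWord i j (M i j)) = cs.wordProd (altWord j i (M i j)) := by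
  have := cs.wordProd_braidWord_eq i j
  rcases braidWord_eq_altWord (M := M) i j with ⟨h1, h2⟩ | ⟨h1, h2⟩
  · rwa [h1, h2] at this
  · rw [h1, h2] at this; exact this.symm

/-- If prepending `i` shortened the word, `s_i` would be an inversion of the shorter alternating
word, that is, a product of `2q + 1` alternating letters with `q + 1 < M i j`; this would give `(s_i
s_j)^(q+1) = 1`. -/
theorem isReduced_altWord [Finite W] {i j : B} (hij : i ≠ j) {k : ℕ} (hk : k ≤ M i j) :
    cs.IsReduced (altWord i j k) := by
  induction k generalizing i j with
  | zero => simp [CoxeterSystem.IsReduced, altWord]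
  | succ k ih =>
    have ih' := ih hij.symm (by rw [M.symmetric j i]; lia)
    have hnd : ¬ cs.IsLeftDescent (cs.wordProd (altWord j i k)) i := by
      intro hd
      have hm := simple_mem_leftInvSeq cs hd
      rw [altWord_eq_take (show k < 2 * (k + 1) by lia), cs.leftInvSeq_take] at hm
      obtain ⟨q, hq, e⟩ := List.getElem_of_mem hm
      rw [List.getElem_take, cs.getElem_leftInvSeq_alternatingWord j i _ _
        (by simp at hq; lia)] at e
      have hqk : q < k := by simp at hq; lia
      rw [cs.prod_alternatingWord_eq_mul_pow, if_neg (by simp [parity_simps]),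
        show (2 * q + 1) / 2 = q by lia] at e
      have h1 : (cs.simple i * cs.simple j) ^ (q + 1) = 1 := by
        rw [pow_succ', mul_assoc, e, cs.simple_mul_simple_self]
      have := (coxeterMatrix_le_of_pow_eq_one cs (Nat.succ_pos q) h1).2
      lia
    rw [cs.not_isLeftDescent_iff, ih'.eq, length_altWord] at hnd
    rw [CoxeterSystem.IsReduced, altWord_succ, cs.wordProd_cons, hnd]
    simp

theorem length_wordProd_altWord [Finite W] {i j : B} (hij : i ≠ j) {k : ℕ} (hk : k ≤ M i j) :
    cs.length (cs.wordProd (altWord i j k)) = k := by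
  rw [(isReduced_altWord cs hij hk).eq, length_altWord]

/-- The letter deleted by the exchange condition cannot lie in `u`, as `i` is not a descent of `u`;
so it lies in `y`. -/
theorem exchange_mul {u y : W} {i : B} (ha : cs.length (u * y) = cs.length u + cs.length y)
    (hu : ¬ cs.IsLeftDescent u i) (huy : cs.IsLeftDescent (u * y) i) :
    ∃ y', u * y = cs.simple i * u * y' ∧ cs.length y = cs.length y' + 1 := by
  obtain ⟨α, hα, rfl⟩ := cs.exists_isReduced u
  obtain ⟨β, hβ, rfl⟩ := cs.exists_isReduced y
  rw [← cs.wordProd_append] at huy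
  obtain ⟨k, hk, e⟩ := exchange cs huy
  rw [List.length_append] at hk
  rw [cs.not_isLeftDescent_iff] at hu
  by_cases hkα : k < α.length
  · exfalso
    rw [List.eraseIdx_append_of_lt_length hkα, cs.wordProd_append, cs.wordProd_append, ← mul_assoc,
      mul_left_inj] at e
    rw [e, hα.eq] at hu
    have := cs.length_wordProd_le (α.eraseIdx k)
    rw [List.length_eraseIdx_of_lt hkα] at this
    lia
  · rw [List.eraseIdx_append_of_length_le (not_lt.1 hkα), cs.wordProd_append,
      cs.wordProd_append] at e
    have e' : cs.wordProd α * cs.wordProd β =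
        cs.simple i * cs.wordProd α * cs.wordProd (β.eraseIdx (k - α.length)) := by
      rw [mul_assoc, ← e, cs.simple_mul_simple_cancel_left]
    refine ⟨_, e', ?_⟩
    have h1 := cs.length_wordProd_le (β.eraseIdx (k - α.length))
    rw [List.length_eraseIdx_of_lt (by lia)] at h1
    have h2 := cs.length_mul_le (cs.simple i * cs.wordProd α)
      (cs.wordProd (β.eraseIdx (k - α.length)))
    rw [← e', ha, hu] at h2
    rw [hβ.eq] at h2 ⊢
    lia

/-- The two descents are exchanged in alternately, each use of `exchange_mul` lengthening the
alternating prefix by one letter; this goes on as long as the prefix is reduced. -/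
theorem exists_eq_altWord_mul [Finite W] {w : W} {i j : B} (hij : i ≠ j)
    (hi : cs.IsLeftDescent w i) (hj : cs.IsLeftDescent w j) :
    ∃ v, w = cs.wordProd (altWord i j (M i j)) * v ∧ cs.length w = M i j + cs.length v := by
  suffices H : ∀ k (i j : B), i ≠ j → cs.IsLeftDescent w i → cs.IsLeftDescent w j → k ≤ M i j →
      ∃ v, w = cs.wordProd (altWord i j k) * v ∧ cs.length w = k + cs.length v from
    H _ i j hij hi hj le_rfl
  intro k
  induction k with
  | zero => intros; exact ⟨w, by simp [altWord]⟩
  | succ k ih =>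
    intro i j hij hi hj hk
    obtain ⟨v, hv, hl⟩ := ih j i hij.symm hj hi (by rw [M.symmetric j i]; lia)
    have hred := length_wordProd_altWord cs hij.symm
      (show k ≤ M j i by rw [M.symmetric j i]; lia)
    obtain ⟨y, hy, hly⟩ := exchange_mul cs (u := cs.wordProd (altWord j i k)) (y := v) (i := i)
      (by rw [← hv, hred, hl])
      (by
        rw [cs.not_isLeftDescent_iff, ← cs.wordProd_cons, ← altWord_succ,
          length_wordProd_altWord cs hij hk, hred])
      (by rwa [← hv])
    refine ⟨y, ?_, by lia⟩
    rw [hv, hy, altWord_succ, cs.wordProd_cons]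

/-- An element of maximal length. -/
def IsLongest (w₀ : W) : Prop := ∀ v, cs.length v ≤ cs.length w₀

variable {cs}

theorem IsLongest.exists_eq_mul {w₀ : W} (h : IsLongest cs w₀) (u : W) :
    ∃ y, w₀ = u * y ∧ cs.length w₀ = cs.length u + cs.length y := by
  obtain ⟨ω, hω, rfl⟩ := cs.exists_isReduced u
  induction ω with
  | nil => exact ⟨w₀, by simp⟩
  | cons i ω ih =>
    have hω' : cs.IsReduced ω := by simpa using hω.drop 1
    obtain ⟨y, hy, hl⟩ := ih hω'
    have hd : cs.IsLeftDescent w₀ i := lt_of_le_of_ne (h _) (cs.length_simple_mul_ne _ _)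
    obtain ⟨y', hy', hl'⟩ := exchange_mul cs (u := cs.wordProd ω) (y := y) (i := i)
      (by rw [← hy, hl])
      (by rw [cs.not_isLeftDescent_iff, ← cs.wordProd_cons, hω.eq, hω'.eq, List.length_cons])
      (by rwa [← hy])
    refine ⟨y', by rw [hy, hy', cs.wordProd_cons], ?_⟩
    rw [hω.eq, List.length_cons, ← hω'.eq]
    lia

theorem IsLongest.length_inv_mul {w₀ : W} (h : IsLongest cs w₀) (u : W) :
    cs.length (u⁻¹ * w₀) + cs.length u = cs.length w₀ := by
  obtain ⟨y, hy, hl⟩ := h.exists_eq_mul u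
  rw [hl, hy, inv_mul_cancel_left, add_comm]

theorem IsLongest.exists_simple_mul_eq {w₀ : W} (h : IsLongest cs w₀) (i : B) :
    ∃ j, cs.simple i * w₀ = w₀ * cs.simple j := by
  have h1 := h.length_inv_mul (cs.simple i * w₀)
  have h2 := h.length_inv_mul (cs.simple i)
  rw [cs.length_simple, cs.inv_simple] at h2
  have h3 : cs.length ((cs.simple i * w₀)⁻¹ * w₀) = 1 := by lia
  obtain ⟨j, hj⟩ := cs.length_eq_one_iff.1 h3
  refine ⟨j, ?_⟩
  rw [← hj, mul_inv_rev, cs.inv_simple]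
  have : w₀ * w₀ = 1 := by
    have := h.length_inv_mul w₀⁻¹
    rw [cs.length_inv, inv_inv] at this
    exact cs.length_eq_zero_iff.1 (by lia)
  have hinv : w₀⁻¹ = w₀ := inv_eq_of_mul_eq_one_left this
  rw [hinv, ← mul_assoc, ← mul_assoc, this, one_mul]

theorem exists_isLongest (cs : CoxeterSystem M W) [Finite W] : ∃ w₀, IsLongest cs w₀ := by
  obtain ⟨w₀, -, h⟩ := Set.exists_max_image Set.univ cs.length Set.finite_univ ⟨1, trivial⟩
  exact ⟨w₀, fun v => h v trivial⟩

/-- Passing to `x⁻¹ w₀` turns right ascents of `x` into left descents, to which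
`exists_eq_altWord_mul` applies. -/
theorem length_mul_altWord (cs : CoxeterSystem M W) [Finite W] {x : W} {j k : B} (hjk : j ≠ k)
    (hj : cs.length (x * cs.simple j) = cs.length x + 1)
    (hk : cs.length (x * cs.simple k) = cs.length x + 1) :
    cs.length (x * cs.wordProd (altWord j k (M j k))) = cs.length x + M j k := by
  obtain ⟨w₀, h₀⟩ := exists_isLongest cs
  have hd : ∀ i, cs.length (x * cs.simple i) = cs.length x + 1 →
      cs.IsLeftDescent (x⁻¹ * w₀) i := by
    intro i hi
    have h1 := h₀.length_inv_mul x
    have h2 := h₀.length_inv_mul (x * cs.simple i)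
    rw [mul_inv_rev, cs.inv_simple, mul_assoc] at h2
    rw [CoxeterSystem.IsLeftDescent]
    lia
  obtain ⟨v, hv, hl⟩ := exists_eq_altWord_mul cs hjk (hd j hj) (hd k hk)
  have h1 := h₀.length_inv_mul x
  have h2 : cs.length w₀ ≤ cs.length (x * cs.wordProd (altWord j k (M j k))) + cs.length v := by
    rw [inv_mul_eq_iff_eq_mul, ← mul_assoc] at hv
    conv_lhs => rw [hv]
    exact cs.length_mul_le _ _
  have h3 := cs.length_mul_le x (cs.wordProd (altWord j k (M j k)))
  rw [length_wordProd_altWord cs hjk le_rfl] at h3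
  lia

/-- Every word contains a reduced word of the same element as a sublist. -/
theorem exists_isReduced_sublist (cs : CoxeterSystem M W) (ω : List B) :
    ∃ ω', ω'.Sublist ω ∧ cs.IsReduced ω' ∧ cs.wordProd ω' = cs.wordProd ω := by
  induction ω with
  | nil => exact ⟨[], .refl _, by simp [CoxeterSystem.IsReduced], rfl⟩
  | cons i ω ih =>
    obtain ⟨ω', hs, hr, e⟩ := ih
    by_cases hd : cs.IsLeftDescent (cs.wordProd ω') i
    · obtain ⟨k, hk, e'⟩ := exchange cs hd
      refine ⟨ω'.eraseIdx k, ((List.eraseIdx_sublist _ _).trans hs).cons i, ?_, ?_⟩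
      · rw [cs.isLeftDescent_iff, e', hr.eq] at hd
        rw [CoxeterSystem.IsReduced, List.length_eraseIdx_of_lt hk]
        lia
      · rw [← e', cs.wordProd_cons, e]
    · rw [cs.not_isLeftDescent_iff] at hd
      refine ⟨i :: ω', hs.cons_cons i, ?_, by rw [cs.wordProd_cons, cs.wordProd_cons, e]⟩
      rw [CoxeterSystem.IsReduced, cs.wordProd_cons, hd, hr.eq, List.length_cons]

end WeakOrder

/-- Newman's lemma: a terminating, locally confluent relation is confluent. -/
theorem exists_normalForm {α : Type*} {r : α → α → Prop} (hwf : WellFounded (flip r))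
    (hloc : ∀ a b c, r a b → r a c →
      ∃ d, Relation.ReflTransGen r b d ∧ Relation.ReflTransGen r c d) (a : α) :
    ∃ m, Relation.ReflTransGen r a m ∧
      ∀ x, Relation.ReflTransGen r a x → Relation.ReflTransGen r x m := by
  induction a using hwf.induction with
  | _ a ih =>
    by_cases hmax : ∃ b, r a b
    · obtain ⟨b, hb⟩ := hmax
      obtain ⟨m, hbm, hm⟩ := ih b hb
      refine ⟨m, .head hb hbm, ?_⟩
      intro x hx
      rcases hx.cases_head with rfl | ⟨c, hc, hcx⟩
      · exact .head hb hbm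
      · obtain ⟨m', hcm', hm'⟩ := ih c hc
        obtain ⟨d, hbd, hcd⟩ := hloc a b c hb hc
        have h1 := hm d hbd
        have h2 := hm' _ (hcd.trans h1)
        exact (hm' x hcx).trans (hm _ (hbd.trans (h1.trans h2)))
    · refine ⟨a, .refl, ?_⟩
      intro x hx
      rcases hx.cases_head with rfl | ⟨c, hc, -⟩
      · exact .refl
      · exact absurd ⟨c, hc⟩ hmax

/-! ### Words and the length function of the Artin–Tits monoid. -/

section WordsAndLength

variable {B : Type u} (M : CoxeterMatrix B)

/-- The product in `B⁺` of a word in the generators. -/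
def artinProd (ω : List B) : ArtinMonoid M := (ω.map (gen M)).prod

@[simp]
theorem artinProd_nil : artinProd M [] = 1 := rfl

@[simp]
theorem artinProd_cons (i : B) (ω : List B) : artinProd M (i :: ω) = gen M i * artinProd M ω := by
  simp [artinProd]

theorem artinProd_append (ω ω' : List B) :
    artinProd M (ω ++ ω') = artinProd M ω * artinProd M ω' := by
  simp [artinProd]

theorem mk_eq_artinProd (ω : List B) :
    PresentedMonoid.mk (braidRel M) (FreeMonoid.ofList ω) = artinProd M ω := by
  induction ω with
  | nil => rfl
  | cons a l ih =>
    rw [FreeMonoid.ofList_cons, map_mul, ih, artinProd_cons]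
    rfl

variable {M}

theorem artinProd_altWord_comm {i j : B} (h : M i j ≠ 0) :
    artinProd M (altWord i j (M i j)) = artinProd M (altWord j i (M i j)) := by
  have : artinProd M (CoxeterSystem.braidWord M i j) =
      artinProd M (CoxeterSystem.braidWord M j i) := by
    rw [← mk_eq_artinProd, ← mk_eq_artinProd]
    exact PresentedMonoid.mk_eq_mk_of_rel ⟨i, j, h, rfl, rfl⟩
  rcases braidWord_eq_altWord (M := M) i j with ⟨h1, h2⟩ | ⟨h1, h2⟩
  · rwa [h1, h2] at this
  · rw [h1, h2] at this; exact this.symm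

theorem artinProd_surjective : Function.Surjective (artinProd M) := by
  intro b
  obtain ⟨ω, rfl⟩ := PresentedMonoid.surjective_mk b
  exact ⟨ω.toList, (mk_eq_artinProd M _).symm⟩

@[elab_as_elim]
theorem artin_induction {p : ArtinMonoid M → Prop} (one : p 1)
    (mul : ∀ i b, p b → p (gen M i * b)) (b : ArtinMonoid M) : p b := by
  obtain ⟨ω, rfl⟩ := artinProd_surjective b
  induction ω with
  | nil => exact one
  | cons i ω ih => rw [artinProd_cons]; exact mul _ _ ih

variable (M) in
/-- The length homomorphism of `B⁺`. -/
def artinLengthHom : ArtinMonoid M →* Multiplicative ℕ :=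
  PresentedMonoid.lift (fun _ => Multiplicative.ofAdd 1) (by
    have key : ∀ l : List B, FreeMonoid.lift (fun _ => Multiplicative.ofAdd 1)
        (FreeMonoid.ofList l) = Multiplicative.ofAdd l.length := by
      intro l
      induction l with
      | nil => rfl
      | cons a l ih =>
        rw [FreeMonoid.ofList_cons, map_mul, ih, FreeMonoid.lift_eval_of, ← ofAdd_add,
          List.length_cons, add_comm]
    rintro _ _ ⟨i, j, h, rfl, rfl⟩
    rw [key, key, CoxeterSystem.length_alternatingWord, CoxeterSystem.length_alternatingWord,
      M.symmetric])

/-- The length of an element of `B⁺`. -/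
def artinLength (b : ArtinMonoid M) : ℕ := Multiplicative.toAdd (artinLengthHom M b)

@[simp]
theorem artinLength_one : artinLength (1 : ArtinMonoid M) = 0 := by
  simp [artinLength]

@[simp]
theorem artinLength_mul (a b : ArtinMonoid M) :
    artinLength (a * b) = artinLength a + artinLength b := by
  simp [artinLength]

@[simp]
theorem artinLength_gen (i : B) : artinLength (gen M i) = 1 := rfl

@[simp]
theorem artinLength_artinProd (ω : List B) : artinLength (artinProd M ω) = ω.length := by
  induction ω with
  | nil => simp
  | cons i ω ih => simp [ih, add_comm]

theorem artinLength_eq_zero {b : ArtinMonoid M} : artinLength b = 0 ↔ b = 1 := by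
  constructor
  · obtain ⟨ω, rfl⟩ := artinProd_surjective b
    intro h
    rw [artinLength_artinProd, List.length_eq_zero_iff] at h
    rw [h, artinProd_nil]
  · rintro rfl; simp

theorem artinLength_eq_one {b : ArtinMonoid M} (h : artinLength b = 1) : ∃ i, b = gen M i := by
  obtain ⟨ω, rfl⟩ := artinProd_surjective b
  rw [artinLength_artinProd, List.length_eq_one_iff] at h
  obtain ⟨i, rfl⟩ := h
  exact ⟨i, by simp⟩

theorem artinLength_le_of_dvd {a b : ArtinMonoid M} (h : a ∣ b) : artinLength a ≤ artinLength b := by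
  obtain ⟨c, rfl⟩ := h
  simp

theorem artin_eq_one_of_dvd_one {b : ArtinMonoid M} (h : b ∣ 1) : b = 1 := by
  have := artinLength_le_of_dvd h
  rw [artinLength_one, Nat.le_zero] at this
  exact artinLength_eq_zero.1 this

end WordsAndLength

/-! ### Matsumoto's theorem and canonical lifts. -/

section CanonicalLift

variable {B : Type u} {W : Type v} [Group W] [Finite W] {M : CoxeterMatrix B}
  (cs : CoxeterSystem M W)

/-- Matsumoto's theorem: reduced words of the same element have the same product in `B⁺`. -/
theorem artinProd_eq_of_isReduced {ω ω' : List B} (h : cs.IsReduced ω) (h' : cs.IsReduced ω')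
    (e : cs.wordProd ω = cs.wordProd ω') : artinProd M ω = artinProd M ω' := by
  induction hn : ω.length using Nat.strong_induction_on generalizing ω ω' with
  | _ n ih =>
    have hlen : ω.length = ω'.length := by rw [← h.eq, ← h'.eq, e]
    rcases ω with _ | ⟨i, α⟩
    · rw [List.length_nil, eq_comm, List.length_eq_zero_iff] at hlen
      rw [hlen]
    rcases ω' with _ | ⟨j, β⟩
    · simp at hlen
    have hα : cs.IsReduced α := by simpa using h.drop 1
    have hβ : cs.IsReduced β := by simpa using h'.drop 1
    simp only [List.length_cons] at hn hlen
    rcases eq_or_ne i j with rfl | hij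
    · rw [artinProd_cons, artinProd_cons, ih α.length (by lia) hα hβ _ rfl]
      simpa [cs.wordProd_cons] using e
    · have hi : cs.IsLeftDescent (cs.wordProd (i :: α)) i := by
        rw [CoxeterSystem.IsLeftDescent, h.eq, cs.wordProd_cons, cs.simple_mul_simple_cancel_left,
          hα.eq]
        simp
      have hj : cs.IsLeftDescent (cs.wordProd (i :: α)) j := by
        rw [CoxeterSystem.IsLeftDescent, e, h'.eq, cs.wordProd_cons,
          cs.simple_mul_simple_cancel_left, hβ.eq]
        simp
      obtain ⟨v, hv, hl⟩ := exists_eq_altWord_mul cs hij hi hj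
      obtain ⟨γ, hγ, rfl⟩ := cs.exists_isReduced v
      have hm := coxeterMatrix_ne_zero cs i j
      obtain ⟨m, hm⟩ := Nat.exists_eq_succ_of_ne_zero hm
      rw [Nat.succ_eq_add_one] at hm
      -- Each of the two words is compared with the alternating word having the same first letter,
      -- followed by the common `γ`; removing that letter brings the induction hypothesis into play.
      -- The two resulting products differ by one braid relation.
      have key : ∀ (k l : B) (δ : List B), cs.IsReduced δ → M k l = m + 1 → δ.length < n →
          cs.wordProd (k :: δ) = cs.wordProd (altWord k l (M k l)) * cs.wordProd γ →
          cs.length (cs.wordProd (k :: δ)) = δ.length + 1 →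
          δ.length + 1 = m + 1 + γ.length →
          artinProd M (k :: δ) = artinProd M (altWord k l (M k l)) * artinProd M γ := by
        intro k l δ hδ hkl hlt heq hlk hlen'
        rw [hkl, altWord_succ, cs.wordProd_cons, cs.wordProd_cons, mul_assoc, mul_right_inj,
          ← cs.wordProd_append] at heq
        have hred : cs.IsReduced (altWord l k m ++ γ) := by
          rw [CoxeterSystem.IsReduced, ← heq, hδ.eq, List.length_append, length_altWord]
          lia
        rw [hkl, altWord_succ, artinProd_cons, artinProd_cons, mul_assoc, ← artinProd_append,
          ih _ hlt hδ hred heq rfl]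
      rw [h.eq, hγ.eq, hm, List.length_cons] at hl
      rw [key i j α hα hm (by lia) hv (by rw [h.eq]; rfl) (by lia),
        key j i β hβ (by rw [M.symmetric, hm]) (by lia)
          (by rw [← e, hv, wordProd_altWord_comm cs, M.symmetric]) (by rw [h'.eq]; rfl) (by lia),
        artinProd_altWord_comm (coxeterMatrix_ne_zero cs i j), M.symmetric j i]

theorem canonicalLift_wordProd {ω : List B} (h : cs.IsReduced ω) :
    canonicalLift cs (cs.wordProd ω) = artinProd M ω := by
  have := (cs.exists_isReduced (cs.wordProd ω)).choose_spec
  exact artinProd_eq_of_isReduced cs this.1 h this.2.symm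

theorem canonicalLift_mul {u v : W} (h : cs.length (u * v) = cs.length u + cs.length v) :
    canonicalLift cs (u * v) = canonicalLift cs u * canonicalLift cs v := by
  obtain ⟨α, hα, rfl⟩ := cs.exists_isReduced u
  obtain ⟨β, hβ, rfl⟩ := cs.exists_isReduced v
  have : cs.IsReduced (α ++ β) := by
    rw [CoxeterSystem.IsReduced, cs.wordProd_append, h, hα.eq, hβ.eq, List.length_append]
  rw [canonicalLift_wordProd cs hα, canonicalLift_wordProd cs hβ, ← cs.wordProd_append,
    canonicalLift_wordProd cs this, artinProd_append]

theorem canonicalLift_one : canonicalLift cs 1 = 1 := by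
  simpa using canonicalLift_wordProd cs (ω := []) (by simp [CoxeterSystem.IsReduced])

theorem canonicalLift_simple (i : B) : canonicalLift cs (cs.simple i) = gen M i := by
  simpa using canonicalLift_wordProd cs (ω := [i]) (by simp [CoxeterSystem.IsReduced])

theorem canonicalLift_altWord {i j : B} (hij : i ≠ j) {k : ℕ} (hk : k ≤ M i j) :
    canonicalLift cs (cs.wordProd (altWord i j k)) = artinProd M (altWord i j k) :=
  canonicalLift_wordProd cs (isReduced_altWord cs hij hk)

theorem artinProd_mem_parabolic {I : Set B} {ω : List B} (h : ∀ i ∈ ω, i ∈ I) :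
    artinProd M ω ∈ parabolic M I :=
  Submonoid.list_prod_mem _ (by
    intro x hx
    obtain ⟨i, hi, rfl⟩ := List.mem_map.1 hx
    exact Submonoid.subset_closure ⟨i, h i hi, rfl⟩)

/-- Reducing a word only deletes letters, so `w` has a reduced word in `I`; by Matsumoto's theorem
this word computes the lift. -/
theorem canonicalLift_mem_parabolic {I : Set B} {w : W}
    (h : w ∈ Subgroup.closure (cs.simple '' I)) : canonicalLift cs w ∈ parabolic M I := by
  have : ∃ ω : List B, (∀ i ∈ ω, i ∈ I) ∧ cs.wordProd ω = w := by
    induction h using Subgroup.closure_induction with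
    | mem x hx =>
      obtain ⟨i, hi, rfl⟩ := hx
      exact ⟨[i], by simpa using hi, by simp⟩
    | one => exact ⟨[], by simp, by simp⟩
    | mul x y _ _ hx hy =>
      obtain ⟨α, hα, rfl⟩ := hx
      obtain ⟨β, hβ, rfl⟩ := hy
      refine ⟨α ++ β, ?_, cs.wordProd_append _ _⟩
      intro i hi
      rcases List.mem_append.1 hi with hi | hi
      exacts [hα i hi, hβ i hi]
    | inv x _ hx =>
      obtain ⟨α, hα, rfl⟩ := hx
      exact ⟨α.reverse, by simpa using hα, cs.wordProd_reverse α⟩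
  obtain ⟨ω, hω, rfl⟩ := this
  obtain ⟨ω', hs, hr, e⟩ := exists_isReduced_sublist cs ω
  rw [← e, canonicalLift_wordProd cs hr]
  exact artinProd_mem_parabolic fun i hi => hω i (hs.subset hi)

end CanonicalLift

/-! ### Least common multiples, left cancellation and left gcds in `B⁺`. -/

section Complement

variable {B : Type u} (M : CoxeterMatrix B)

/-- The word `ω` such that `i ω` is the alternating word of length `M i j` starting with `i`. -/
def complementWord (i j : B) : List B := altWord j i (M i j - 1)

theorem cons_complementWord {i j : B} (h : M i j ≠ 0) :
    i :: complementWord M i j = altWord i j (M i j) := by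
  rw [complementWord, ← altWord_succ]
  congr 1
  lia

/-- `B⁺`-elements `x`, `y` such that `s_i x` and `s_j y` are the same multiple of the least common
multiple of `s_i` and `s_j`. -/
def IsLcmMultiple (i : B) (x : ArtinMonoid M) (j : B) (y : ArtinMonoid M) : Prop :=
  (i = j ∧ x = y) ∨ (i ≠ j ∧ ∃ z, x = artinProd M (complementWord M i j) * z ∧
    y = artinProd M (complementWord M j i) * z)

variable {M}

theorem IsLcmMultiple.refl (i : B) (x : ArtinMonoid M) : IsLcmMultiple M i x i x :=
  .inl ⟨rfl, rfl⟩

theorem IsLcmMultiple.symm {i j : B} {x y : ArtinMonoid M} (h : IsLcmMultiple M i x j y) :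
    IsLcmMultiple M j y i x := by
  rcases h with ⟨rfl, rfl⟩ | ⟨hij, z, hx, hy⟩
  · exact .refl _ _
  · exact .inr ⟨hij.symm, z, hy, hx⟩

theorem artinProd_cons_complementWord {i j : B} (h : M i j ≠ 0) :
    gen M i * artinProd M (complementWord M i j) = artinProd M (altWord i j (M i j)) := by
  rw [← cons_complementWord M h, artinProd_cons]

theorem length_complementWord (i j : B) : (complementWord M i j).length = M i j - 1 := by
  rw [complementWord, length_altWord]

theorem not_isLeftDescent_of_mul {W : Type v} [Group W] (cs : CoxeterSystem M W) {a : W} {j k : B}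
    (h : cs.length (a * cs.simple j) = cs.length a + 1)
    (hk : ¬ cs.IsLeftDescent (a * cs.simple j) k) : ¬ cs.IsLeftDescent a k := by
  rw [cs.not_isLeftDescent_iff] at hk ⊢
  have h1 := cs.length_mul_le (cs.simple k * a) (cs.simple j)
  rw [cs.length_simple, mul_assoc] at h1
  rcases cs.length_simple_mul a k with h2 | h2 <;> lia

/-! ### Consequences of the lcm property of generators, assumed only below a length bound, for use
inside its own induction. -/

section Bounded

variable {n : ℕ}
  (ih : ∀ (i j : B) (x y : ArtinMonoid M), artinLength x < n → gen M i * x = gen M j * y →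
    IsLcmMultiple M i x j y)

include ih

theorem mul_left_cancel_of_length_le (a : ArtinMonoid M) {x y : ArtinMonoid M}
    (hn : artinLength (a * x) ≤ n) (h : a * x = a * y) : x = y := by
  induction a using artin_induction with
  | one => simpa using h
  | mul i a iha =>
    rw [mul_assoc] at hn h
    rw [artinLength_mul, artinLength_gen] at hn
    rw [mul_assoc] at h
    rcases ih i i _ _ (by lia) h with ⟨-, h'⟩ | ⟨hne, -⟩
    · exact iha (by lia) h'
    · exact absurd rfl hne

theorem exists_eq_mul_altWord_of_length_le {a z x y : ArtinMonoid M} {i j : B} (hij : i ≠ j)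
    (hm : M i j ≠ 0) (hn : artinLength z ≤ n) (hx : z = a * gen M i * x)
    (hy : z = a * gen M j * y) : ∃ z', z = a * artinProd M (altWord i j (M i j)) * z' := by
  have h : a * (gen M i * x) = a * (gen M j * y) := by rw [← mul_assoc, ← mul_assoc, ← hx, hy]
  have h' := mul_left_cancel_of_length_le ih a (by rwa [← mul_assoc, ← hx]) h
  have hlt : artinLength x < n := by
    rw [hx] at hn
    simp at hn
    lia
  rcases ih i j x y hlt h' with ⟨e, -⟩ | ⟨-, z', hz, -⟩
  · exact absurd e hij
  · refine ⟨z', ?_⟩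
    rw [hx, hz, ← artinProd_cons_complementWord hm]
    simp only [mul_assoc]

variable {W : Type v} [Group W] [Finite W] (cs : CoxeterSystem M W)

/-- Newman's lemma for extension by one letter on the right. Termination comes from the finiteness
of `W`. For local confluence, two extensions of `a` by `i` and `j` meet at `a` times the alternating
word of length `M i j`: the bounded lcm property makes its lift divide `z`, and `length_mul_altWord`
applied to `s_k a` keeps `k` from being a left descent. -/
theorem exists_max_canonicalLift_dvd {z : ArtinMonoid M} (hz : artinLength z ≤ n) (k : B) :
    ∃ m : W, canonicalLift cs m ∣ z ∧ ¬ cs.IsLeftDescent m k ∧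
      ∀ u, canonicalLift cs u ∣ z → ¬ cs.IsLeftDescent u k →
        ∃ q, m = u * q ∧ cs.length m = cs.length u + cs.length q := by
  let r : W → W → Prop := fun u v => ∃ j, v = u * cs.simple j ∧
    cs.length (u * cs.simple j) = cs.length u + 1 ∧ canonicalLift cs v ∣ z ∧
      ¬ cs.IsLeftDescent v k
  obtain ⟨w₀, h₀⟩ := exists_isLongest cs
  have hwf : WellFounded (flip r) := by
    refine Subrelation.wf ?_ (measure fun u => cs.length w₀ - cs.length u).wf
    rintro v u ⟨j, rfl, hl, -⟩
    have := h₀ (u * cs.simple j)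
    change cs.length w₀ - cs.length (u * cs.simple j) < cs.length w₀ - cs.length u
    lia
  have reach : ∀ (a : W) (ω : List B),
      cs.length (a * cs.wordProd ω) = cs.length a + ω.length →
      canonicalLift cs (a * cs.wordProd ω) ∣ z → ¬ cs.IsLeftDescent (a * cs.wordProd ω) k →
      Relation.ReflTransGen r a (a * cs.wordProd ω) := by
    intro a ω
    induction ω using List.reverseRecOn with
    | nil => intros; simpa using Relation.ReflTransGen.refl
    | append_singleton ω j ihω =>
      rw [cs.wordProd_append, cs.wordProd_singleton, ← mul_assoc, List.length_append,
        List.length_singleton]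
      intro hl hd hk
      have h1 := cs.length_mul_le a (cs.wordProd ω)
      have h2 := cs.length_wordProd_le ω
      have h3 := cs.length_mul_le (a * cs.wordProd ω) (cs.simple j)
      rw [cs.length_simple] at h3
      have hl' : cs.length (a * cs.wordProd ω * cs.simple j) =
        cs.length (a * cs.wordProd ω) + 1 := by lia
      refine (ihω (by lia) ?_ (not_isLeftDescent_of_mul cs hl' hk)).tail ⟨j, rfl, hl', hd, hk⟩
      rw [canonicalLift_mul cs (by rw [cs.length_simple, hl'])] at hd
      exact (Dvd.intro _ rfl).trans hd
  have hloc : ∀ a b c, r a b → r a c →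
      ∃ d, Relation.ReflTransGen r b d ∧ Relation.ReflTransGen r c d := by
    rintro a _ _ ⟨i, rfl, hli, hdi, hki⟩ ⟨j, rfl, hlj, hdj, hkj⟩
    rcases eq_or_ne i j with rfl | hij
    · exact ⟨_, .refl, .refl⟩
    have hak : ¬ cs.IsLeftDescent a k := not_isLeftDescent_of_mul cs hli hki
    have hm := coxeterMatrix_ne_zero cs i j
    have hlen := length_mul_altWord cs hij hli hlj
    have hlenk : ¬ cs.IsLeftDescent (a * cs.wordProd (altWord i j (M i j))) k := by
      rw [cs.not_isLeftDescent_iff] at hki hkj hak ⊢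
      rw [← mul_assoc] at hki hkj ⊢
      rw [length_mul_altWord cs hij (by lia) (by lia)]
      lia
    have hdvd : canonicalLift cs (a * cs.wordProd (altWord i j (M i j))) ∣ z := by
      rw [canonicalLift_mul cs (by rw [cs.length_simple, hli]), canonicalLift_simple] at hdi
      rw [canonicalLift_mul cs (by rw [cs.length_simple, hlj]), canonicalLift_simple] at hdj
      obtain ⟨x, hx⟩ := hdi
      obtain ⟨y, hy⟩ := hdj
      obtain ⟨z', hz'⟩ := exists_eq_mul_altWord_of_length_le ih hij hm hz hx hy
      refine ⟨z', ?_⟩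
      rw [canonicalLift_mul cs (by rw [hlen, length_wordProd_altWord cs hij le_rfl]),
        canonicalLift_altWord cs hij le_rfl, hz']
    have hlast : ∀ i' j', i' ≠ j' → cs.length (a * cs.simple i') = cs.length a + 1 →
        M i' j' = M i j → cs.wordProd (altWord i' j' (M i j)) = cs.wordProd (altWord i j (M i j)) →
        Relation.ReflTransGen r (a * cs.simple i')
          (a * cs.wordProd (altWord i j (M i j))) := by
      intro i' j' hij' hl' hM hw
      have e : a * cs.wordProd (altWord i j (M i j)) =
          a * cs.simple i' * cs.wordProd (complementWord M i' j') := by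
        rw [← hw, ← hM, ← cons_complementWord M (by lia), cs.wordProd_cons, mul_assoc]
      rw [e] at hlenk hdvd hlen ⊢
      refine reach (a * cs.simple i') (complementWord M i' j') ?_ hdvd hlenk
      rw [hlen, hl', length_complementWord]
      lia
    exact ⟨_, hlast i j hij hli rfl rfl, hlast j i hij.symm hlj (M.symmetric _ _)
      (wordProd_altWord_comm cs i j).symm⟩
  obtain ⟨m, h1m, hm⟩ := exists_normalForm hwf hloc 1
  have hP : canonicalLift cs m ∣ z ∧ ¬ cs.IsLeftDescent m k := by
    rcases h1m.cases_tail with rfl | ⟨u, -, j, rfl, -, h1, h2⟩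
    · exact ⟨by simp [canonicalLift_one], cs.not_isLeftDescent_one k⟩
    · exact ⟨h1, h2⟩
  refine ⟨m, hP.1, hP.2, ?_⟩
  intro u hu hk
  have hreach : Relation.ReflTransGen r 1 u := by
    obtain ⟨ω, hω, rfl⟩ := cs.exists_isReduced u
    simpa using reach 1 ω (by rw [one_mul, hω.eq]; simp) (by simpa using hu) (by simpa using hk)
  have h2 := hm u hreach
  clear * - h2
  induction h2 with
  | refl => exact ⟨1, by simp⟩
  | tail _ hbc ihq =>
    obtain ⟨q, rfl, hl⟩ := ihq
    obtain ⟨j, rfl, hl', -⟩ := hbc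
    refine ⟨q * cs.simple j, mul_assoc _ _ _, ?_⟩
    have h1 := cs.length_mul_le u (q * cs.simple j)
    have h2 := cs.length_mul_le q (cs.simple j)
    rw [cs.length_simple] at h2
    rw [← mul_assoc] at h1
    lia

include cs in
-- The problem is moved to `W`: let `m` be the largest element without left descent `k` whose lift
-- divides `z`. Both complements are reduced prefixes of `m`, so `s_k m` has `i` and `j` as left
-- descents and hence the alternating element of length `M i j` as a prefix. Lifting this
-- factorization back gives the common `z'`.
theorem cube {z z₁ z₂ : ArtinMonoid M} (hz : artinLength z ≤ n) {i j k : B} (hij : i ≠ j)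
    (hki : k ≠ i) (hkj : k ≠ j) (h₁ : z = artinProd M (complementWord M k i) * z₁)
    (h₂ : z = artinProd M (complementWord M k j) * z₂) :
    ∃ z', artinProd M (complementWord M i k) * z₁ = artinProd M (complementWord M i j) * z' ∧
      artinProd M (complementWord M j k) * z₂ = artinProd M (complementWord M j i) * z' := by
  obtain ⟨m, ⟨z', hmz⟩, hmk, hmax⟩ := exists_max_canonicalLift_dvd ih cs hz k
  have hred : ∀ {a b : B}, a ≠ b → cs.IsReduced (complementWord M a b) := by
    intro a b hab
    exact isReduced_altWord cs hab.symm (by rw [M.symmetric b a]; lia)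
  have hlen : ∀ {a b : B}, a ≠ b →
      cs.length (cs.wordProd (complementWord M a b)) + 1 = M a b := by
    intro a b hab
    have := coxeterMatrix_ne_zero cs a b
    rw [(hred hab).eq, length_complementWord]
    lia
  have hcons : ∀ a b : B, cs.simple a * cs.wordProd (complementWord M a b) =
      cs.wordProd (altWord a b (M a b)) := by
    intro a b
    rw [← cs.wordProd_cons, cons_complementWord M (coxeterMatrix_ne_zero cs a b)]
  have hcomm : ∀ a b : B, cs.simple a * cs.wordProd (complementWord M a b) =
      cs.simple b * cs.wordProd (complementWord M b a) := by
    intro a b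
    rw [hcons, hcons, wordProd_altWord_comm, M.symmetric]
  have hmax' : ∀ l z₃, k ≠ l → z = artinProd M (complementWord M k l) * z₃ →
      ∃ q, m = cs.wordProd (complementWord M k l) * q ∧
        cs.length m = cs.length (cs.wordProd (complementWord M k l)) + cs.length q ∧
        z₃ = canonicalLift cs q * z' := by
    intro l z₃ hkl h₃
    obtain ⟨q, hq, hl⟩ := hmax (cs.wordProd (complementWord M k l))
      (by rw [canonicalLift_wordProd cs (hred hkl)]; exact ⟨_, h₃⟩)
      (by
        rw [cs.not_isLeftDescent_iff, hcons, length_wordProd_altWord cs hkl le_rfl, hlen hkl])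
    refine ⟨q, hq, hl, mul_left_cancel_of_length_le ih (artinProd M (complementWord M k l)) ?_ ?_⟩
    · rwa [← h₃]
    · rw [← h₃, ← mul_assoc, ← canonicalLift_wordProd cs (hred hkl),
        ← canonicalLift_mul cs (by rw [← hq, hl]), ← hq, hmz]
  rw [cs.not_isLeftDescent_iff] at hmk
  -- The element `s_k m` starts with the longest element of the dihedral group of `k` and `l`;
  -- rewriting this prefix to start with `l` shows that `l` is a left descent.
  have hdesc : ∀ l q, k ≠ l → m = cs.wordProd (complementWord M k l) * q →
      cs.length m = cs.length (cs.wordProd (complementWord M k l)) + cs.length q →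
      cs.length (cs.wordProd (complementWord M l k) * q) = cs.length m ∧
        cs.length m = cs.length (cs.wordProd (complementWord M l k)) + cs.length q ∧
        cs.simple l * (cs.simple k * m) = cs.wordProd (complementWord M l k) * q := by
    intro l q hkl hq hl
    have e : cs.simple l * (cs.simple k * m) = cs.wordProd (complementWord M l k) * q := by
      rw [hq, ← mul_assoc (cs.simple k), hcomm, mul_assoc, cs.simple_mul_simple_cancel_left]
    have e1 := hlen hkl
    have e2 := hlen hkl.symm
    rw [M.symmetric] at e2
    have h3 := cs.length_mul_le (cs.wordProd (complementWord M l k)) q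
    have h4 := cs.length_simple_mul (cs.simple k * m) l
    rw [e] at h4
    exact ⟨by lia, by lia, e⟩
  obtain ⟨v₁, hv₁, hl₁, rfl⟩ := hmax' i z₁ hki h₁
  obtain ⟨v₂, hv₂, hl₂, rfl⟩ := hmax' j z₂ hkj h₂
  obtain ⟨a₁, b₁, e₁⟩ := hdesc i v₁ hki hv₁ hl₁
  obtain ⟨a₂, b₂, e₂⟩ := hdesc j v₂ hkj hv₂ hl₂
  obtain ⟨v, hv, hl⟩ := exists_eq_altWord_mul cs hij
    (show cs.IsLeftDescent (cs.simple k * m) i by rw [CoxeterSystem.IsLeftDescent, e₁]; lia)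
    (show cs.IsLeftDescent (cs.simple k * m) j by rw [CoxeterSystem.IsLeftDescent, e₂]; lia)
  have hlij := hlen hij
  have hlji := hlen hij.symm
  rw [M.symmetric] at hlji
  have f₁ : cs.wordProd (complementWord M i k) * v₁ = cs.wordProd (complementWord M i j) * v := by
    rw [← e₁, hv, ← hcons, mul_assoc, cs.simple_mul_simple_cancel_left]
  have f₂ : cs.wordProd (complementWord M j k) * v₂ = cs.wordProd (complementWord M j i) * v := by
    rw [← e₂, hv, ← hcons, hcomm, mul_assoc, cs.simple_mul_simple_cancel_left]
  have g₁ := congrArg (canonicalLift cs) f₁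
  have g₂ := congrArg (canonicalLift cs) f₂
  rw [canonicalLift_mul cs (by lia), canonicalLift_mul cs (by rw [← f₁]; lia),
    canonicalLift_wordProd cs (hred hki.symm), canonicalLift_wordProd cs (hred hij)] at g₁
  rw [canonicalLift_mul cs (by lia), canonicalLift_mul cs (by rw [← f₂]; lia),
    canonicalLift_wordProd cs (hred hkj.symm), canonicalLift_wordProd cs (hred hij.symm)] at g₂
  exact ⟨canonicalLift cs v * z', by rw [← mul_assoc, g₁, mul_assoc],
    by rw [← mul_assoc, g₂, mul_assoc]⟩

include cs in
theorem IsLcmMultiple.trans_of_length_le {i j k : B} {x y z : ArtinMonoid M}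
    (hz : artinLength z ≤ n) (h₁ : IsLcmMultiple M i x k z) (h₂ : IsLcmMultiple M k z j y) :
    IsLcmMultiple M i x j y := by
  rcases h₁ with ⟨rfl, rfl⟩ | ⟨hik, z₁, hx, hz₁⟩
  · exact h₂
  rcases h₂ with ⟨rfl, rfl⟩ | ⟨hkj, z₂, hz₂, hy⟩
  · exact .inr ⟨hik, z₁, hx, hz₁⟩
  rcases eq_or_ne i j with rfl | hij
  · refine .inl ⟨rfl, ?_⟩
    have := mul_left_cancel_of_length_le ih _ (by rwa [← hz₁]) (hz₁.symm.trans hz₂)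
    rw [hx, hy, this]
  · obtain ⟨z', e₁, e₂⟩ := cube ih cs hz hij hik.symm hkj hz₁ hz₂
    exact .inr ⟨hij, z', by rw [hx, e₁], by rw [hy, e₂]⟩

end Bounded

/-- Induction on a derivation from the braid relations. The arbitrary suffix `c` serves the product
case, where the left factor is rewritten in front of the unchanged right one; once the left factor
is nonempty, rewriting the right factor does not touch the first letter. -/
theorem isLcmMultiple_of_rel {n : ℕ}
    (trans : ∀ {i j k : B} {x y z : ArtinMonoid M}, artinLength z = n →
      IsLcmMultiple M i x k z → IsLcmMultiple M k z j y → IsLcmMultiple M i x j y)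
    {a b : FreeMonoid B} (h : ConGen.Rel (braidRel M) a b) (c : FreeMonoid B) :
    ∀ i j (x y : List B), (a * c).toList = i :: x → (b * c).toList = j :: y → x.length = n →
      IsLcmMultiple M i (artinProd M x) j (artinProd M y) := by
  have hmk : ∀ {a b : FreeMonoid B}, ConGen.Rel (braidRel M) a b →
      artinProd M a.toList = artinProd M b.toList := by
    intro a b h
    rw [← mk_eq_artinProd, ← mk_eq_artinProd]
    exact PresentedMonoid.mk_eq_mk_iff.2 h
  have hlen : ∀ {a b : FreeMonoid B}, ConGen.Rel (braidRel M) a b →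
      a.toList.length = b.toList.length := by
    intro a b h
    rw [← artinLength_artinProd (M := M), hmk h, artinLength_artinProd]
  induction h generalizing c with
  | of a b h =>
    obtain ⟨i, j, hm, rfl, rfl⟩ := h
    intro i' j' x y hx hy hn
    simp only [FreeMonoid.toList_mul, FreeMonoid.toList_ofList] at hx hy
    rcases eq_or_ne i j with rfl | hij
    · rw [hx] at hy
      obtain ⟨rfl, rfl⟩ := List.cons_eq_cons.1 hy
      exact .refl _ _
    have key : ∀ k l : B, k ≠ l → M k l = M i j → altWord k l (M i j) ++ c.toList = i' :: x →
        altWord l k (M i j) ++ c.toList = j' :: y →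
        IsLcmMultiple M i' (artinProd M x) j' (artinProd M y) := by
      intro k l hkl hM h1 h2
      rw [← hM, ← cons_complementWord M (by lia), List.cons_append] at h1
      rw [← hM, M.symmetric, ← cons_complementWord M (by rw [M.symmetric]; lia),
        List.cons_append] at h2
      obtain ⟨rfl, rfl⟩ := List.cons_eq_cons.1 h1
      obtain ⟨rfl, rfl⟩ := List.cons_eq_cons.1 h2
      exact .inr ⟨hkl, artinProd M c.toList, artinProd_append _ _ _, artinProd_append _ _ _⟩
    rcases braidWord_eq_altWord (M := M) i j with ⟨h1, h2⟩ | ⟨h1, h2⟩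
    · rw [h1] at hx
      rw [h2] at hy
      exact key i j hij rfl hx hy
    · rw [h1] at hx
      rw [h2] at hy
      exact key j i hij.symm (M.symmetric _ _) hx hy
  | refl a =>
    intro i j x y hx hy hn
    rw [hx] at hy
    obtain ⟨rfl, rfl⟩ := List.cons_eq_cons.1 hy
    exact .refl _ _
  | @symm a b h ih =>
    intro i j x y hx hy hn
    refine (ih c j i y x hy hx ?_).symm
    have h1 := congrArg List.length hx
    have h2 := congrArg List.length hy
    have h3 := hlen h
    simp at h1 h2
    lia
  | @trans a b d h₁ h₂ ih₁ ih₂ =>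
    intro i j x y hx hy hn
    have h1 := congrArg List.length hx
    have h3 := hlen h₁
    rcases hb : (b * c).toList with _ | ⟨k, z⟩
    · have h2 := congrArg List.length hb
      rw [FreeMonoid.toList_mul, List.length_append] at h1 h2
      simp only [List.length_cons, List.length_nil] at h1 h2
      lia
    · have h2 := congrArg List.length hb
      simp at h1 h2
      have hz : z.length = n := by lia
      exact trans (by simpa using hz) (ih₁ c i k x z hx hb hn) (ih₂ c k j z y hb hy hz)
  | @mul a b d e h₁ h₂ ih₁ ih₂ =>
    intro i j x y hx hy hn
    rw [mul_assoc] at hx hy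
    have h1 := congrArg List.length hx
    have h3 := hlen h₁
    have h4 := hlen h₂
    rcases hb : b.toList with _ | ⟨k, z⟩
    · have ha : a.toList = [] := by rw [← List.length_eq_zero_iff, h3, hb]; rfl
      rw [FreeMonoid.toList_mul, ha, List.nil_append] at hx
      rw [FreeMonoid.toList_mul, hb, List.nil_append] at hy
      exact ih₂ c i j x y hx hy hn
    · have hbd : (b * (d * c)).toList = k :: (z ++ (d * c).toList) := by
        rw [FreeMonoid.toList_mul, hb, List.cons_append]
      have h5 := congrArg List.length hbd
      simp at h1 h5
      refine trans (z := artinProd M (z ++ (d * c).toList)) (by simp; lia)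
        (ih₁ (d * c) i k x _ hx hbd hn) ?_
      rw [FreeMonoid.toList_mul, hb, List.cons_append] at hy
      obtain ⟨rfl, rfl⟩ := List.cons_eq_cons.1 hy
      refine .inl ⟨rfl, ?_⟩
      simp only [artinProd_append, FreeMonoid.toList_mul, hmk h₂]

variable {W : Type v} [Group W] [Finite W] (cs : CoxeterSystem M W)

include cs

/-- Two multiples of generators are equal only if both are multiples of the least common multiple
of these generators. -/
theorem isLcmMultiple_of_mul_eq {i j : B} {x y : ArtinMonoid M}
    (h : gen M i * x = gen M j * y) : IsLcmMultiple M i x j y := by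
  induction hn : artinLength x using Nat.strong_induction_on generalizing i j x y with
  | _ n ih =>
    obtain ⟨α, rfl⟩ := artinProd_surjective x
    obtain ⟨β, rfl⟩ := artinProd_surjective y
    rw [← artinProd_cons, ← artinProd_cons, ← mk_eq_artinProd, ← mk_eq_artinProd] at h
    exact isLcmMultiple_of_rel
      (fun hz => IsLcmMultiple.trans_of_length_le
        (fun i j x y hx hxy => ih _ hx hxy rfl) cs hz.le)
      (PresentedMonoid.mk_eq_mk_iff.1 h) 1 i j α β (by simp) (by simp) (by simpa using hn)

theorem artin_mul_left_cancel (a : ArtinMonoid M) {x y : ArtinMonoid M} (h : a * x = a * y) :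
    x = y :=
  mul_left_cancel_of_length_le (n := artinLength (a * x))
    (fun _ _ _ _ _ hxy => isLcmMultiple_of_mul_eq cs hxy) a le_rfl h

/-- Left greatest common divisors exist in `B⁺`. -/
theorem exists_artin_gcd (x y : ArtinMonoid M) :
    ∃ g, g ∣ x ∧ g ∣ y ∧ ∀ d, d ∣ x → d ∣ y → d ∣ g := by
  let r : ArtinMonoid M → ArtinMonoid M → Prop := fun a b => ∃ i, b = a * gen M i ∧ b ∣ x ∧ b ∣ y
  have hwf : WellFounded (flip r) := by
    refine Subrelation.wf ?_ (measure fun a => artinLength x - artinLength a).wf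
    rintro b a ⟨i, rfl, hx, -⟩
    have := artinLength_le_of_dvd hx
    change artinLength x - artinLength (a * gen M i) < artinLength x - artinLength a
    simp at this ⊢
    lia
  have reach : ∀ (a : ArtinMonoid M) (ω : List B), a * artinProd M ω ∣ x → a * artinProd M ω ∣ y →
      Relation.ReflTransGen r a (a * artinProd M ω) := by
    intro a ω
    induction ω generalizing a with
    | nil => intros; simpa using Relation.ReflTransGen.refl
    | cons i ω ih =>
      rw [artinProd_cons, ← mul_assoc]
      intro hx hy
      exact .head ⟨i, rfl, (Dvd.intro _ rfl).trans hx, (Dvd.intro _ rfl).trans hy⟩ (ih _ hx hy)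
  have hloc : ∀ a b c, r a b → r a c →
      ∃ d, Relation.ReflTransGen r b d ∧ Relation.ReflTransGen r c d := by
    rintro a _ _ ⟨i, rfl, hix, hiy⟩ ⟨j, rfl, hjx, hjy⟩
    rcases eq_or_ne i j with rfl | hij
    · exact ⟨_, .refl, .refl⟩
    have hm := coxeterMatrix_ne_zero cs i j
    -- Local confluence for Newman's lemma: common divisors that extend `a` by two different
    -- generators extend further to `a` times their lcm, which still divides `x` and `y`.
    have key : ∀ z, a * gen M i ∣ z → a * gen M j ∣ z →
        a * artinProd M (altWord i j (M i j)) ∣ z := by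
      rintro z ⟨p, hp⟩ ⟨q, hq⟩
      obtain ⟨z', hz'⟩ := exists_eq_mul_altWord_of_length_le
        (fun _ _ _ _ _ hxy => isLcmMultiple_of_mul_eq cs hxy) hij hm le_rfl hp hq
      exact ⟨z', hz'⟩
    have h1 := key x hix hjx
    have h2 := key y hiy hjy
    have e1 : a * artinProd M (altWord i j (M i j)) =
        a * gen M i * artinProd M (complementWord M i j) := by
      rw [← artinProd_cons_complementWord hm, mul_assoc]
    have e2 : a * artinProd M (altWord i j (M i j)) =
        a * gen M j * artinProd M (complementWord M j i) := by
      rw [mul_assoc, artinProd_cons_complementWord (by rwa [M.symmetric]),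
        artinProd_altWord_comm hm, M.symmetric]
    refine ⟨a * artinProd M (altWord i j (M i j)), ?_, ?_⟩
    · rw [e1] at h1 h2 ⊢
      exact reach _ _ h1 h2
    · rw [e2] at h1 h2 ⊢
      exact reach _ _ h1 h2
  obtain ⟨g, h1g, hg⟩ := exists_normalForm hwf hloc 1
  have hP : g ∣ x ∧ g ∣ y := by
    rcases h1g.cases_tail with rfl | ⟨u, -, j, rfl, h1, h2⟩
    · exact ⟨one_dvd _, one_dvd _⟩
    · exact ⟨h1, h2⟩
  refine ⟨g, hP.1, hP.2, ?_⟩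
  intro d hdx hdy
  obtain ⟨ω, rfl⟩ := artinProd_surjective d
  have h2 := hg _ (by simpa using reach 1 ω (by simpa using hdx) (by simpa using hdy))
  clear * - h2
  induction h2 with
  | refl => exact dvd_rfl
  | tail _ hbc ihq =>
    obtain ⟨i, rfl, -⟩ := hbc
    exact ihq.mul_right _

end Complement

/-! ### Ribbons: products, quotients, gcds and lcms with parabolic elements. -/

section Ribbons

variable {B : Type u} {M : CoxeterMatrix B}

theorem exists_word_of_mem_parabolic {I : Set B} {a : ArtinMonoid M} (h : a ∈ parabolic M I) :
    ∃ ω : List B, (∀ i ∈ ω, i ∈ I) ∧ a = artinProd M ω := by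
  induction h using Submonoid.closure_induction with
  | mem x hx =>
    obtain ⟨i, hi, rfl⟩ := hx
    exact ⟨[i], by simpa using hi, by simp⟩
  | one => exact ⟨[], by simp, by simp⟩
  | mul x y _ _ hx hy =>
    obtain ⟨α, hα, rfl⟩ := hx
    obtain ⟨β, hβ, rfl⟩ := hy
    refine ⟨α ++ β, ?_, (artinProd_append _ _ _).symm⟩
    intro i hi
    rcases List.mem_append.1 hi with hi | hi
    exacts [hα i hi, hβ i hi]

theorem gen_mem_parabolic {I : Set B} {s : B} (h : s ∈ I) : gen M s ∈ parabolic M I :=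
  Submonoid.subset_closure ⟨s, h, rfl⟩

theorem gen_ne_one (s : B) : gen M s ≠ 1 := by
  intro h
  have := congrArg artinLength h
  simp at this

theorem isAlpha_one_iff {I : Set B} {b : ArtinMonoid M} :
    IsAlpha M I b 1 ↔ ∀ s ∈ I, ¬ gen M s ∣ b := by
  constructor
  · intro h s hs hsb
    exact gen_ne_one s (artin_eq_one_of_dvd_one (h.2.2 _ (gen_mem_parabolic hs) hsb))
  · intro h
    refine ⟨Submonoid.one_mem _, one_dvd _, ?_⟩
    intro x hx hxb
    obtain ⟨ω, hω, rfl⟩ := exists_word_of_mem_parabolic hx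
    rcases ω with _ | ⟨i, ω⟩
    · simp
    · rw [artinProd_cons] at hxb
      exact absurd ((Dvd.intro _ rfl).trans hxb) (h i (hω i (by simp)))

theorem eq_one_or_eq_of_dvd_gen {e : ArtinMonoid M} {t : B} (h : e ∣ gen M t) :
    e = 1 ∨ e = gen M t := by
  obtain ⟨f, hf⟩ := h
  have := congrArg artinLength hf
  rw [artinLength_gen, artinLength_mul] at this
  obtain h0 | h0 : artinLength e = 0 ∨ artinLength f = 0 := by lia
  · exact .inl (artinLength_eq_zero.1 h0)
  · rw [artinLength_eq_zero.1 h0, mul_one] at hf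
    exact .inr hf.symm

variable (M) in
/-- The morphisms `I ⟶ J` of the ribbon category, as elements of `B⁺`. -/
def IsRibbon (I : Set B) (b : ArtinMonoid M) (J : Set B) : Prop :=
  ConjEq M I b J ∧ IsAlpha M I b 1

theorem IsRibbon.one (I : Set B) : IsRibbon M I 1 I :=
  ⟨ConjEq.one M I, isAlpha_one_iff.2 fun s _ h => gen_ne_one s (artin_eq_one_of_dvd_one h)⟩

theorem IsRibbon.map (φ : DiagramAut M) {I J : Set B} {b : ArtinMonoid M} (h : IsRibbon M I b J) :
    IsRibbon M (φ.toEquiv '' I) (φ.aut b) (φ.toEquiv '' J) :=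
  ⟨h.1.map φ, by simpa using h.2.map φ⟩

theorem ConjEq.exists_mul_comm_of_mem_right {I J : Set B} {b : ArtinMonoid M} (h : ConjEq M I b J)
    {a : ArtinMonoid M} (ha : a ∈ parabolic M J) : ∃ a' ∈ parabolic M I, b * a = a' * b := by
  induction ha using Submonoid.closure_induction with
  | mem x hx =>
    obtain ⟨t, ht, rfl⟩ := hx
    obtain ⟨s, hs, e⟩ := h.2 t ht
    exact ⟨_, gen_mem_parabolic hs, e.symm⟩
  | one => exact ⟨1, Submonoid.one_mem _, by simp⟩
  | mul x y _ _ hx hy =>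
    obtain ⟨x', hx', ex⟩ := hx
    obtain ⟨y', hy', ey⟩ := hy
    exact ⟨x' * y', Submonoid.mul_mem _ hx' hy', by rw [← mul_assoc, ex, mul_assoc, ey, mul_assoc]⟩

variable {W : Type v} [Group W] [Finite W] (cs : CoxeterSystem M W)

include cs

theorem artin_dvd_of_mul_dvd_mul {a x y : ArtinMonoid M} (h : a * x ∣ a * y) : x ∣ y := by
  obtain ⟨c, hc⟩ := h
  rw [mul_assoc] at hc
  exact ⟨c, artin_mul_left_cancel cs a hc⟩

/-- Left multiplication commutes with gcds: the gcd of `ax` and `ay` is a multiple of `a`, and the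
cofactor divides both `x` and `y`. -/
theorem artin_dvd_mul_of_gcd {a x y g d : ArtinMonoid M} (hg : ∀ e, e ∣ x → e ∣ y → e ∣ g)
    (hx : d ∣ a * x) (hy : d ∣ a * y) : d ∣ a * g := by
  obtain ⟨g', hx', hy', hg'⟩ := exists_artin_gcd cs (a * x) (a * y)
  obtain ⟨e, rfl⟩ := hg' a (Dvd.intro _ rfl) (Dvd.intro _ rfl)
  exact (hg' d hx hy).trans (mul_dvd_mul_left a
    (hg e (artin_dvd_of_mul_dvd_mul cs hx') (artin_dvd_of_mul_dvd_mul cs hy')))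

/-- Otherwise `t` and `c` are coprime, and `s`, dividing both `bt` and `bc`, would divide `b`. -/
theorem gen_dvd_of_dvd_mul {b c : ArtinMonoid M} {s t : B} (hst : gen M s * b = b * gen M t)
    (hs : ¬ gen M s ∣ b) (h : gen M s ∣ b * c) : gen M t ∣ c := by
  by_contra ht
  refine hs ?_
  rw [← mul_one b]
  refine artin_dvd_mul_of_gcd cs (x := gen M t) (y := c) ?_ ⟨b, hst.symm⟩ h
  intro e he hec
  rcases eq_one_or_eq_of_dvd_gen he with rfl | rfl
  · exact dvd_rfl
  · exact absurd hec ht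

theorem IsRibbon.mul {I J K : Set B} {b c : ArtinMonoid M} (hb : IsRibbon M I b J)
    (hc : IsRibbon M J c K) : IsRibbon M I (b * c) K := by
  refine ⟨hb.1.mul hc.1, isAlpha_one_iff.2 fun s hs hsbc => ?_⟩
  obtain ⟨t, ht, e⟩ := hb.1.1 s hs
  exact isAlpha_one_iff.1 hc.2 t ht
    (gen_dvd_of_dvd_mul cs e (isAlpha_one_iff.1 hb.2 s hs) hsbc)

theorem IsRibbon.of_mul {I J K : Set B} {b c : ArtinMonoid M} (hb : IsRibbon M I b J)
    (hbc : IsRibbon M I (b * c) K) : IsRibbon M J c K := by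
  have key : ∀ {s t r : B}, gen M s * b = b * gen M t → gen M s * (b * c) = b * c * gen M r →
      gen M t * c = c * gen M r := by
    intro s t r h h'
    apply artin_mul_left_cancel cs b
    rw [← mul_assoc, ← h, mul_assoc, h', mul_assoc]
  refine ⟨⟨?_, ?_⟩, isAlpha_one_iff.2 ?_⟩
  · intro t ht
    obtain ⟨s, hs, e⟩ := hb.1.2 t ht
    obtain ⟨r, hr, e'⟩ := hbc.1.1 s hs
    exact ⟨r, hr, key e e'⟩
  · intro r hr
    obtain ⟨s, hs, e'⟩ := hbc.1.2 r hr
    obtain ⟨t, ht, e⟩ := hb.1.1 s hs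
    exact ⟨t, ht, key e e'⟩
  · rintro t ht ⟨d, rfl⟩
    obtain ⟨s, hs, e⟩ := hb.1.2 t ht
    refine isAlpha_one_iff.1 hbc.2 s hs ?_
    rw [← mul_assoc, ← e, mul_assoc]
    exact Dvd.intro _ rfl

/-- For `s` in `I`, `g` divides `sb = bt` and `sc = cr`, hence divides `sg`; by length the quotient
is a single generator. -/
theorem IsRibbon.gcd {I J K : Set B} {b c g : ArtinMonoid M} (hb : IsRibbon M I b J)
    (hc : IsRibbon M I c K) (hgb : g ∣ b) (hgc : g ∣ c) (hg : ∀ d, d ∣ b → d ∣ c → d ∣ g) :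
    ∃ L, IsRibbon M I g L := by
  have key : ∀ s ∈ I, ∃ t, gen M s * g = g * gen M t := by
    intro s hs
    obtain ⟨t, -, e⟩ := hb.1.1 s hs
    obtain ⟨r, -, e'⟩ := hc.1.1 s hs
    obtain ⟨x, hx⟩ : g ∣ gen M s * g := artin_dvd_mul_of_gcd cs hg
      (by rw [e]; exact hgb.mul_right _) (by rw [e']; exact hgc.mul_right _)
    have hl := congrArg artinLength hx
    simp only [artinLength_mul, artinLength_gen] at hl
    obtain ⟨i, rfl⟩ := artinLength_eq_one (show artinLength x = 1 by lia)
    exact ⟨i, hx⟩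
  refine ⟨{t | ∃ s ∈ I, gen M s * g = g * gen M t}, ⟨?_, fun t ht => ht⟩, isAlpha_one_iff.2 ?_⟩
  · intro s hs
    obtain ⟨t, ht⟩ := key s hs
    exact ⟨t, ⟨s, hs, ht⟩, ht⟩
  · intro s hs h
    exact isAlpha_one_iff.1 hb.2 s hs (h.trans hgb)

/-- This says that `ab` is the lcm of `a` and `b`. The letters of `a` are pulled one at a time
through `b` and split off `c`. -/
theorem IsRibbon.mul_dvd_of_dvd {I J : Set B} {a b c : ArtinMonoid M} (hb : IsRibbon M I b J)
    (ha : a ∈ parabolic M I) (h : a ∣ b * c) : a * b ∣ b * c := by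
  obtain ⟨ω, hω, rfl⟩ := exists_word_of_mem_parabolic ha
  clear ha
  induction ω generalizing c with
  | nil => simp
  | cons s ω ih =>
    rw [artinProd_cons] at h ⊢
    have hs : s ∈ I := hω s (by simp)
    obtain ⟨t, -, e⟩ := hb.1.1 s hs
    obtain ⟨c', rfl⟩ := gen_dvd_of_dvd_mul cs e (isAlpha_one_iff.1 hb.2 s hs)
      ((Dvd.intro _ rfl).trans h)
    have e' : b * (gen M t * c') = gen M s * (b * c') := by rw [← mul_assoc, ← e, mul_assoc]
    rw [e'] at h ⊢
    rw [mul_assoc]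
    exact mul_dvd_mul_left _ (ih (fun i hi => hω i (by simp [hi]))
      (artin_dvd_of_mul_dvd_mul cs h))

omit cs in
/-- A common multiple of the generators which is quasi-central. -/
def IsQuasiCentralMultiple (D : ArtinMonoid M) : Prop :=
  (∀ i, gen M i ∣ D) ∧ ∀ c, ∃ c', c * D = D * c'

omit [Finite W] in
omit cs in
theorem IsQuasiCentralMultiple.map (φ : DiagramAut M) {D : ArtinMonoid M}
    (h : IsQuasiCentralMultiple D) : IsQuasiCentralMultiple (φ.aut D) := by
  constructor
  · intro i
    have := map_dvd φ.aut (h.1 (φ.toEquiv.symm i))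
    simpa using this
  · intro c
    obtain ⟨c', hc'⟩ := h.2 (φ.aut.symm c)
    refine ⟨φ.aut c', ?_⟩
    have := congrArg φ.aut hc'
    simpa using this

omit cs in
theorem isQuasiCentralMultiple_canonicalLift {cs : CoxeterSystem M W} {w₀ : W}
    (h : IsLongest cs w₀) : IsQuasiCentralMultiple (canonicalLift cs w₀) := by
  have hlen : ∀ i, cs.length (cs.simple i * w₀) + 1 = cs.length w₀ := by
    intro i
    have := h.length_inv_mul (cs.simple i)
    rwa [cs.length_simple, cs.inv_simple] at this
  have hmul : ∀ i, canonicalLift cs w₀ = gen M i * canonicalLift cs (cs.simple i * w₀) := by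
    intro i
    rw [← canonicalLift_simple cs, ← canonicalLift_mul cs, cs.simple_mul_simple_cancel_left]
    rw [cs.simple_mul_simple_cancel_left, cs.length_simple, ← hlen i, add_comm]
  refine ⟨fun i => ⟨_, hmul i⟩, ?_⟩
  intro c
  induction c using artin_induction with
  | one => exact ⟨1, by simp⟩
  | mul i c ih =>
    obtain ⟨c', hc'⟩ := ih
    obtain ⟨j, hj⟩ := h.exists_simple_mul_eq i
    refine ⟨gen M j * c', ?_⟩
    have e : canonicalLift cs w₀ = canonicalLift cs (cs.simple i * w₀) * gen M j := by
      have e1 : cs.simple i * w₀ * cs.simple j = w₀ := by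
        rw [hj, cs.simple_mul_simple_cancel_right]
      rw [← canonicalLift_simple cs, ← canonicalLift_mul cs, e1]
      rw [e1, cs.length_simple, hlen]
    rw [mul_assoc, hc', ← mul_assoc, ← mul_assoc]
    conv_lhs => rw [e]
    rw [← mul_assoc, ← hmul]

end Ribbons

/-! ### Twisted powers `w φ(w) ⋯ φⁿ⁻¹(w)` and their divisors. -/

section Twisted

variable {B : Type u} {M : CoxeterMatrix B} (φ : DiagramAut M)

/-- The element `w φ(w) ⋯ φⁿ⁻¹(w)`. -/
def twistedPow (w : ArtinMonoid M) : ℕ → ArtinMonoid M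
  | 0 => 1
  | n + 1 => w * φ.aut (twistedPow w n)

theorem twistedPow_succ (w : ArtinMonoid M) (n : ℕ) :
    twistedPow φ w (n + 1) = w * φ.aut (twistedPow φ w n) := rfl

theorem twistedPow_add (w : ArtinMonoid M) (m n : ℕ) :
    twistedPow φ w (m + n) = twistedPow φ w m * (φ.aut)^[m] (twistedPow φ w n) := by
  induction m with
  | zero => simp [twistedPow]
  | succ m ih =>
    rw [Nat.succ_add, twistedPow_succ, ih, twistedPow_succ, map_mul, mul_assoc,
      Function.iterate_succ_apply']

theorem coset_pow_left (w : ArtinMonoid M) (n : ℕ) :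
    (Semidirect.coset φ.aut w ^ n).left = twistedPow φ w n := by
  induction n with
  | zero => rfl
  | succ n ih =>
    rw [pow_succ', twistedPow_succ, ← ih]
    rfl

theorem dvd_twistedPow_of_inl_dvd {w δ : ArtinMonoid M} {n : ℕ}
    (h : Semidirect.inl φ.aut δ ∣ Semidirect.coset φ.aut w ^ n) : δ ∣ twistedPow φ w n := by
  obtain ⟨c, hc⟩ := h
  exact ⟨c.left, by rw [← coset_pow_left, hc]; rfl⟩

theorem commute_inl_coset_iff {w b : ArtinMonoid M} :
    Commute (Semidirect.inl φ.aut b) (Semidirect.coset φ.aut w) ↔ b * w = w * φ.aut b := by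
  constructor
  · intro h
    exact congrArg Semidirect.left h
  · intro h
    apply Semidirect.ext
    · exact h
    · exact (one_mul _).trans (mul_one _).symm

theorem iterate_mem_parabolic {I : Set B} {a : ArtinMonoid M} (h : a ∈ parabolic M I) (n : ℕ) :
    (φ.aut)^[n] a ∈ parabolic M ((φ.toEquiv '' ·)^[n] I) := by
  induction n with
  | zero => exact h
  | succ n ih =>
    rw [Function.iterate_succ_apply', Function.iterate_succ_apply', ← parabolic_map]
    exact ⟨_, ih, rfl⟩

theorem ConjEq.twistedPow {I : Set B} {w : ArtinMonoid M} (h : ConjEq M I w (φ.toEquiv '' I))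
    (n : ℕ) : ConjEq M I (twistedPow φ w n) ((φ.toEquiv '' ·)^[n] I) := by
  induction n with
  | zero => exact ConjEq.one M I
  | succ n ih =>
    rw [Function.iterate_succ_apply']
    exact h.mul (ih.map φ)

theorem twistedPow_conj {w w' g : ArtinMonoid M} (h : g * w' = w * φ.aut g) (n : ℕ) :
    twistedPow φ w n ∣ g * twistedPow φ w' n := by
  induction n with
  | zero => exact one_dvd _
  | succ n ih =>
    rw [twistedPow_succ, twistedPow_succ, ← mul_assoc, h, mul_assoc, ← map_mul]
    exact mul_dvd_mul_left _ (map_dvd φ.aut ih)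

/-- If some multiple of `D` lies in `B_I⁺ · w φ(w) ⋯ φⁿ⁻¹(w)`, then every element divides an
element of this form for a larger exponent. -/
theorem exists_dvd_parabolic_mul_twistedPow {I : Set B} {w D a₀ y : ArtinMonoid M} {n : ℕ}
    (hw : ConjEq M I w (φ.toEquiv '' I)) (hD : IsQuasiCentralMultiple D)
    (ha₀ : a₀ ∈ parabolic M I) (h : a₀ * twistedPow φ w n = D * y) (b : ArtinMonoid M) :
    ∃ N, ∃ a ∈ parabolic M I, b ∣ a * twistedPow φ w N := by
  obtain ⟨ω, rfl⟩ := artinProd_surjective b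
  induction ω using List.reverseRecOn with
  | nil => exact ⟨0, 1, Submonoid.one_mem _, by simp⟩
  | append_singleton ω i ih =>
    obtain ⟨N, a, ha, c, hc⟩ := ih
    have hDN : IsQuasiCentralMultiple ((φ.aut)^[N] D) := by
      clear hc
      induction N with
      | zero => exact hD
      | succ N ihN => rw [Function.iterate_succ_apply']; exact ihN.map φ
    -- With `b c = a w⁽ᴺ⁾`, the factor `φᴺ(a₀)` is moved left across `w⁽ᴺ⁾`, so that `a a' w⁽ᴺ⁺ⁿ⁾ =
    -- b c φᴺ(D) φᴺ(y)`. Moving `c` past the quasi-central `φᴺ(D)` puts the required generator just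
    -- after `b`.
    obtain ⟨a', ha', e⟩ := (hw.twistedPow φ N).exists_mul_comm_of_mem_right
      (iterate_mem_parabolic φ ha₀ N)
    refine ⟨N + n, a * a', Submonoid.mul_mem _ ha ha', ?_⟩
    have e2 : (φ.aut)^[N] a₀ * (φ.aut)^[N] (twistedPow φ w n) =
        (φ.aut)^[N] D * (φ.aut)^[N] y := by
      rw [← iterate_map_mul, h, iterate_map_mul]
    obtain ⟨c', hc'⟩ := hDN.2 c
    rw [twistedPow_add, mul_assoc, ← mul_assoc a', ← e, mul_assoc, e2, ← mul_assoc, hc,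
      artinProd_append, mul_assoc, ← mul_assoc c, hc', mul_assoc]
    refine mul_dvd_mul_left _ (Dvd.dvd.mul_right ?_ _)
    simpa using hDN.1 i

variable {W : Type v} [Group W] [Finite W] (cs : CoxeterSystem M W)

include cs

/-- The condition `α_I(b) = 1` removes the parabolic factor: `b` and `a` both divide `a w⁽ᴺ⁾`, so
`ab` does, and `a` cancels. -/
theorem IsRibbon.exists_dvd_twistedPow {I J : Set B} {w D a₀ y b : ArtinMonoid M} {n : ℕ}
    (hw : ConjEq M I w (φ.toEquiv '' I)) (hD : IsQuasiCentralMultiple D)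
    (ha₀ : a₀ ∈ parabolic M I) (h : a₀ * ParabolicBraid.twistedPow φ w n = D * y)
    (hb : IsRibbon M I b J) : ∃ N, b ∣ ParabolicBraid.twistedPow φ w N := by
  obtain ⟨N, a, ha, c, hc⟩ := exists_dvd_parabolic_mul_twistedPow φ hw hD ha₀ h b
  refine ⟨N, ?_⟩
  have := hb.mul_dvd_of_dvd cs (c := c) ha (by rw [← hc]; exact Dvd.intro _ rfl)
  rw [← hc] at this
  exact artin_dvd_of_mul_dvd_mul cs this

/-- An element `b` with `b w' = w φ(b)` that is prime to `w` is prime to `w φ(w) ⋯ φⁿ⁻¹(w)`. -/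
theorem eq_one_of_dvd_twistedPow {w w' b : ArtinMonoid M} (h : b * w' = w * φ.aut b)
    (hg : ∀ d, d ∣ b → d ∣ w → d = 1) (n : ℕ) {d : ArtinMonoid M} (hb : d ∣ b)
    (hd : d ∣ twistedPow φ w n) : d = 1 := by
  induction n generalizing d with
  | zero => exact artin_eq_one_of_dvd_one hd
  | succ n ih =>
    refine hg d hb ?_
    rw [← mul_one w]
    -- Here `d` divides `b w' = w φ(b)` and `w φ(w⁽ⁿ⁾)`; by induction `φ(b)` and `φ(w⁽ⁿ⁾)` are
    -- coprime, so `d` divides `w`.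
    refine artin_dvd_mul_of_gcd cs (x := φ.aut b) (y := φ.aut (twistedPow φ w n)) ?_
      (by rw [← h]; exact hb.mul_right _) hd
    intro e he he'
    have h1 := map_dvd φ.aut.symm he
    have h2 := map_dvd φ.aut.symm he'
    rw [MulEquiv.symm_apply_apply] at h1 h2
    have h3 := congrArg φ.aut (ih h1 h2)
    rw [MulEquiv.apply_symm_apply, map_one] at h3
    rw [h3]

end Twisted

/-! ### Factorization into simple morphisms. -/

section Endomorphisms

variable {B : Type u} {M : CoxeterMatrix B} {𝓘 : Set (Set B)}
variable {W : Type v} [Group W] [Finite W] (cs : CoxeterSystem M W)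

theorem IsConjOrbit.mem_of_conjEq (h : IsConjOrbit M 𝓘) {J K : Set B} (hJ : J ∈ 𝓘)
    {b : ArtinMonoid M} (hb : ConjEq M J b K) : K ∈ 𝓘 := by
  obtain ⟨J₀, rfl⟩ := h
  exact Relation.EqvGen.trans _ _ _ hJ (Relation.EqvGen.rel _ _ ⟨b, hb⟩)

/-- The morphism of the ribbon category defined by an element of `B⁺`. -/
def IsRibbon.toHom {J K : RibbonCat M 𝓘} {b : ArtinMonoid M}
    (h : IsRibbon M J.obj.carrier b K.obj.carrier) : J ⟶ K :=
  ⟨⟨b, h.1⟩, .of _ h.2⟩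

theorem ribbonCat_hom_ext {J K : RibbonCat M 𝓘} {f g : J ⟶ K} (h : f.hom.1 = g.hom.1) : f = g :=
  WideSubcategory.hom_ext _ (Subtype.ext h)

include cs in
theorem isRibbon_of_multiplicativeClosure {J K : AdObj M 𝓘} {f : J ⟶ K}
    (hf : (reduced M 𝓘).multiplicativeClosure f) : IsRibbon M J.carrier f.1 K.carrier := by
  induction hf with
  | of f hf => exact ⟨f.2, hf⟩
  | id x => exact IsRibbon.one _
  | comp_of f g _ hg ih => exact ih.mul cs ⟨g.2, hg⟩

include cs in
theorem isRibbon_hom {J K : RibbonCat M 𝓘} (f : J ⟶ K) :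
    IsRibbon M J.obj.carrier f.hom.1 K.obj.carrier :=
  isRibbon_of_multiplicativeClosure cs f.property

variable {φ : DiagramAut M} {hφ : ∀ J ∈ 𝓘, φ.toEquiv '' J ∈ 𝓘}

include cs in
-- The quotient of a ribbon by a ribbon is a ribbon, so divisibility in the category is divisibility
-- in `B⁺`.
theorem simpleFAd_iff_dvd {X Y : FAd (ribbonFunctor φ hφ)} (f : X ⟶ Y) :
    simpleFAd (ribbonFunctor φ hφ) f ↔ f.1.hom.1 ∣ X.mor.hom.1 := by
  constructor
  · rintro ⟨y, hy⟩
    exact ⟨y.hom.1, congrArg (fun g => g.hom.1) hy⟩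
  · rintro ⟨y, hy⟩
    have hX := isRibbon_hom cs X.mor
    rw [hy] at hX
    exact ⟨((isRibbon_hom cs f.1).of_mul cs hX).toHom, ribbonCat_hom_ext hy⟩

theorem fAd_hom_eq {X Y : FAd (ribbonFunctor φ hφ)} (f : X ⟶ Y) :
    f.1.hom.1 * Y.mor.hom.1 = X.mor.hom.1 * φ.aut f.1.hom.1 :=
  congrArg (fun g => g.hom.1) f.2

include cs in
-- Induction on length: split off `ad g` for `g` the gcd of the morphism and its source. The
-- intermediate set `L` is an object because `𝓘` is closed under conjugation.
theorem multiplicativeClosure_simpleFAd_of_dvd (h𝓘 : IsConjOrbit M 𝓘)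
    {X Y : FAd (ribbonFunctor φ hφ)} (f : X ⟶ Y) (N : ℕ)
    (hN : f.1.hom.1 ∣ twistedPow φ X.mor.hom.1 N) :
    (simpleFAd (ribbonFunctor φ hφ)).multiplicativeClosure f := by
  induction hn : artinLength f.1.hom.1 using Nat.strong_induction_on generalizing X with
  | _ n ih =>
    obtain ⟨g, ⟨b₁, hb₁⟩, ⟨w₁, hw₁⟩, hg⟩ := exists_artin_gcd cs f.1.hom.1 X.mor.hom.1
    have hf := isRibbon_hom cs f.1
    have hX := isRibbon_hom cs X.mor
    have hfX := fAd_hom_eq f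
    by_cases hg1 : g = 1
    · have : f.1.hom.1 = 1 := eq_one_of_dvd_twistedPow φ cs hfX
        (fun d h1 h2 => artin_eq_one_of_dvd_one (hg1 ▸ hg d h1 h2)) N dvd_rfl hN
      -- With underlying element `1`, `f` is itself simple; this avoids identifying `X` with `Y`.
      exact .of _ ((simpleFAd_iff_dvd cs f).2 (by rw [this]; exact one_dvd _))
    · obtain ⟨L, hL⟩ := hf.gcd cs hX ⟨b₁, hb₁⟩ ⟨w₁, hw₁⟩ hg
      let K : RibbonCat M 𝓘 := ⟨⟨L, h𝓘.mem_of_conjEq X.base.obj.mem hL.1⟩⟩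
      have hw₁' : IsRibbon M L w₁ (φ.toEquiv '' X.base.obj.carrier) :=
        hL.of_mul cs (by rw [← hw₁]; exact hX)
      have hb₁' : IsRibbon M L b₁ Y.base.obj.carrier := hL.of_mul cs (by rw [← hb₁]; exact hf)
      have hZ : IsRibbon M K.obj.carrier (w₁ * φ.aut g)
          ((ribbonFunctor φ hφ).obj K).obj.carrier := hw₁'.mul cs (hL.map φ)
      let Z : FAd (ribbonFunctor φ hφ) := ⟨K, hZ.toHom⟩
      have e₁ : g * (w₁ * φ.aut g) = X.mor.hom.1 * φ.aut g := by rw [hw₁, mul_assoc]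
      have e₂ : b₁ * Y.mor.hom.1 = w₁ * φ.aut g * φ.aut b₁ := by
        apply artin_mul_left_cancel cs g
        rw [← mul_assoc, ← hb₁, hfX, hw₁, mul_assoc, mul_assoc, ← map_mul, ← hb₁]
      let f₁ : X ⟶ Z := ⟨IsRibbon.toHom (J := X.base) (K := K) hL, ribbonCat_hom_ext e₁⟩
      let f₂ : Z ⟶ Y := ⟨IsRibbon.toHom (J := K) (K := Y.base) hb₁', ribbonCat_hom_ext e₂⟩
      have hff : f = f₁ ≫ f₂ := Subtype.ext (ribbonCat_hom_ext hb₁)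
      rw [hff]
      refine MorphismProperty.comp_mem _ _ _
        (.of _ ((simpleFAd_iff_dvd cs f₁).2 ⟨w₁, hw₁⟩)) (ih _ ?_ f₂ ?_ rfl)
      · have h1 := congrArg artinLength hb₁
        rw [artinLength_mul, hn] at h1
        have h2 : artinLength g ≠ 0 := fun h => hg1 (artinLength_eq_zero.1 h)
        change artinLength b₁ < n
        lia
      -- The bound `N` is kept: `g b₁` divides `w⁽ᴺ⁾`, which divides `g` times the twisted power of
      -- the new source `w₁ φ(g)`; then `g` cancels.
      · refine artin_dvd_of_mul_dvd_mul cs (a := g) ?_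
        change g * b₁ ∣ g * twistedPow φ (w₁ * φ.aut g) N
        rw [← hb₁]
        exact hN.trans (twistedPow_conj φ e₁ N)

theorem isLongest_longestElement : IsLongest cs (longestElement cs Set.univ) := by
  intro v
  refine (exists_longest cs Set.univ).choose_spec.2 v ?_
  rw [Set.image_univ, cs.subgroup_closure_range_simple]
  trivial

end Endomorphisms

end ParabolicBraid

open ParabolicBraid in
theorem mainTheorem1 {B : Type u} {W : Type v} [Group W] [Finite W] {M : CoxeterMatrix B}
    (cs : CoxeterSystem M W) (φ : ParabolicBraid.DiagramAut M)
    (𝓘 : Set (Set B)) (h𝓘 : ParabolicBraid.IsConjOrbit M 𝓘)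
    (hφ : ∀ J ∈ 𝓘, φ.toEquiv '' J ∈ 𝓘)
    (X : ParabolicBraid.DPlus φ hφ)
    (δ : ParabolicBraid.ArtinMonoid M)
    (hδ : ParabolicBraid.canonicalLift cs (ParabolicBraid.longestElement cs X.source) * δ =
      ParabolicBraid.canonicalLift cs (ParabolicBraid.longestElement cs Set.univ))
    (hdiv : ∃ n : ℕ, ParabolicBraid.Semidirect.inl φ.aut δ ∣
      ParabolicBraid.Semidirect.coset φ.aut X.elt ^ n) :
    ∃ S : Submonoid (ParabolicBraid.ArtinMonoid M),
      (∀ b, b ∈ S ↔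
        Commute (ParabolicBraid.Semidirect.inl φ.aut b)
            (ParabolicBraid.Semidirect.coset φ.aut X.elt) ∧
          ParabolicBraid.ConjEq M X.source b X.source ∧
          ParabolicBraid.IsAlpha M X.source b 1) ∧
      ∃ e : (End X)ᵐᵒᵖ ≃* S,
        ∀ f : X ⟶ X, (e (MulOpposite.op f) : ParabolicBraid.ArtinMonoid M) =
          ParabolicBraid.DPlus.adElt f := by
  let S : Submonoid (ArtinMonoid M) :=
    { carrier := {b | b * X.elt = X.elt * φ.aut b ∧ IsRibbon M X.source b X.source}
      one_mem' := ⟨by simp, IsRibbon.one _⟩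
      mul_mem' := by
        rintro a b ⟨ha, ha'⟩ ⟨hb, hb'⟩
        refine ⟨?_, ha'.mul cs hb'⟩
        rw [mul_assoc, hb, ← mul_assoc, ha, mul_assoc, map_mul] }
  have hw : IsRibbon M X.source X.elt (φ.toEquiv '' X.source) := isRibbon_hom cs X.obj.mor
  have hmem : ∀ f : X ⟶ X, DPlus.adElt f ∈ S := fun f =>
    ⟨fAd_hom_eq f.hom, isRibbon_hom cs f.hom.1⟩
  -- Multiplication in `End X` composes from right to left; the opposite monoid restores the order
  -- of `B⁺`.
  let F : (End X)ᵐᵒᵖ →* S :=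
    { toFun := fun f => ⟨DPlus.adElt f.unop, hmem f.unop⟩
      map_one' := rfl
      map_mul' := fun _ _ => rfl }
  have hinj : Function.Injective F := by
    intro f g h
    apply MulOpposite.unop_injective
    have h' : DPlus.adElt f.unop = DPlus.adElt g.unop := congrArg (fun x : S => x.1) h
    exact WideSubcategory.hom_ext _ (Subtype.ext (ribbonCat_hom_ext h'))
  have hsurj : Function.Surjective F := by
    rintro ⟨b, hb, hb'⟩
    obtain ⟨n, hn⟩ := hdiv
    obtain ⟨y, hy⟩ := dvd_twistedPow_of_inl_dvd φ hn
    -- Applied with `a₀ = w_I` and `D = w₀`: from `w⁽ⁿ⁾ = δ y` one gets `w_I w⁽ⁿ⁾ = w₀ y`.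
    obtain ⟨N, hN⟩ := IsRibbon.exists_dvd_twistedPow φ cs (y := y) (n := n) hw.1
      (isQuasiCentralMultiple_canonicalLift (isLongest_longestElement cs))
      (canonicalLift_mem_parabolic cs (exists_longest cs X.source).choose_spec.1)
      (by rw [hy, ← mul_assoc, ← hδ]; rfl) hb'
    let f : X.obj ⟶ X.obj :=
      ⟨IsRibbon.toHom (J := X.obj.base) (K := X.obj.base) hb', ribbonCat_hom_ext hb⟩
    exact ⟨MulOpposite.op ⟨f, multiplicativeClosure_simpleFAd_of_dvd cs h𝓘 f N hN⟩, rfl⟩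
  refine ⟨S, ?_, MulEquiv.ofBijective F ⟨hinj, hsurj⟩, fun f => rfl⟩
  intro b
  rw [commute_inl_coset_iff]
  rfl
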